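/- **Theorem (oracle query as a quantum gradient phase estimation).** Let $X,\Delta$ be Hermitian operators on $n$ qubits (for instance $\Delta=\Delta(i,j)$, the symmetric $0/1$ matrix marking the entries of $X$ that are varied). For real $W,L>0$ and integers $N\ge1$, $m\ge 0$ put $M=2^m$. *Quantum gradient phase estimation* (QGPE) with $m$ answer qubits, up to its final inverse quantum Fourier transform, applies a Hadamard gate to each answer qubit and then one time evolution under the joint Hamiltonian $2\pi\big(\tfrac{N}{WL}\,I\otimes X+\sum_{j<m}\tfrac{2^j}{W}|1\rangle\langle1|_j\otimes\Delta\big)$. *Quantum phase estimation* (QPE) of $V=e^{2\pi i\Delta/W}$, up to its final inverse quantum Fourier transform, applies the Hadamard gates and then, for every $j<m$, the gate $V^{2^j}$ controlled by answer qubit $j$. A Hadamard gate costs $1$, and a time evolution costs $1$ per Hamiltonian term, each term being controlled by at most one answer qubit (evolutions on the state register are assumed to be efficiently available, as in QPE). 1. *Oracle as a phase estimation.* The time evolution in QGPE is exactly $\sum_{\epsilon=0}^{M-1}|\epsilon\rangle\langle\epsilon|\otimes U(\epsilon)$ with $$U(\epsilon)=\exp\Big(\tfrac{2\pi iN}{WL}\big(X+\tfrac{L\epsilon}{N}\Delta\big)\Big).$$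 The Hadamard gates turn $|0\rangle^{\otimes m}\otimes|\psi\rangle$ into $M^{-1/2}\sum_\epsilon|\epsilon\rangle\otimes|\psi\rangle$, and QGPE turns it into $M^{-1/2}\sum_{\epsilon}|\epsilon\rangle\otimes U(\epsilon)|\psi\rangle$. If $X\Delta=\Delta X$, then QGPE is exactly $I\otimes e^{2\pi i NX/(WL)}$ followed by QPE of $V$. For real $r$, QPE of $e^{2\pi i r\Delta}$ (with the same circuit) turns $|0\rangle^{\otimes m}\otimes|\psi\rangle$, where $r\Delta\psi=x\psi$, into $M^{-1/2}\sum_\epsilon e^{2\pi i\epsilon x}|\epsilon\rangle\otimes|\psi\rangle$. 2. *Action on eigenvectors.* Let $Xp=Ep$ with $\|p\|=1$, and suppose $\langle q,\Delta p\rangle=0$ for every $q\perp p$ with $Xq=Eq$ (automatic if $E$ is a simple eigenvalue). Then there are $g\in\mathbb R$ and $\lambda:\mathbb R\to\mathbb R$, not depending on $N,W,L,m$, such that $\lambda(t)$ is an eigenvalue of $X+t\Delta$ for every $t$, $\lambda(0)=E$, $\lambda'(0)=g$ and $\lambda(t)=E+gt+O(t^2)$ as $t\to0$. For all $N,W,m$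 there is $C$ such that, for every $L>0$, the following hold up to an error of Euclidean norm at most $CL$, with $\alpha=e^{2\pi i NE/(WL)}$ a global phase: - QGPE applied to $|0\rangle^{\otimes m}\otimes|p\rangle$ equals $M^{-1/2}\sum_\epsilon e^{2\pi i\frac{N}{WL}\lambda(L\epsilon/N)}|\epsilon\rangle\otimes|p\rangle$, the oracle query of the quantum gradient algorithm for the function $\lambda$; - it equals $\alpha M^{-1/2}\sum_\epsilon e^{2\pi i\epsilon g/W}|\epsilon\rangle\otimes|p\rangle$, the QPE state for eigenphase $g/W$; - after the inverse quantum Fourier transform on the answer register it equals $\frac{\alpha}{M}\sum_{b,\epsilon}e^{-2\pi i\epsilon(b-Mg/W)/M}|b\rangle\otimes|p\rangle$, and equals $\alpha|b\rangle\otimes|p\rangle$ whenever $\frac{M}{W}g\equiv b \pmod M$ for an integer $0\le b<M$. If moreover $\Delta p=gp$, then $C=0$: all of this is exact. 3. *Scaling.* The cost of QGPE is that of QPE plus one. It is $O(m)$: there is an absolute constant $K$ such that the cost is at most $Km$ for every $m\ge1$. In the setting of 2, let $0<\varepsilon<1$ and $m=\lceil\log_2(1/\varepsilon)\rceil$. Then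 for all $N,W$ there is $C$ (with $C=0$ if $\Delta p=gp$) such that for every $L>0$ the measured outcome $b$ of the answer register satisfies $|b/M-g/W|\le\varepsilon$ modulo $1$ with probability at least $8/\pi^2-CL$; and if $\varepsilon\le\frac12$, the cost is at most $K\log_2(1/\varepsilon)$ for every $L>0$. -/

import Mathlib

open scoped Matrix Kronecker Topology
open Filter Asymptotics

noncomputable section

namespace QGPE

/-- Bit strings of length `k`: the computational basis of a register of `k` qubits. -/
abbrev Bits (k : ℕ) : Type := Fin k → Bool

/-- Operators on a register of `k` qubits. -/
abbrev Op (k : ℕ) : Type := Matrix (Bits k) (Bits k) ℂ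

/-- The integer with binary digits `a`, digit `j` having weight `2 ^ j`. -/
def bitValue {k : ℕ} (a : Bits k) : ℕ := ∑ j : Fin k, if a j then 2 ^ (j : ℕ) else 0

/-- Operators on the answer register (`m` qubits) together with the state register (`n` qubits). -/
abbrev JointOp (m n : ℕ) : Type := Matrix (Bits m × Bits n) (Bits m × Bits n) ℂ

/-- (Not necessarily normalized) state vectors of the two registers. -/
abbrev JointState (m n : ℕ) : Type := Bits m × Bits n → ℂ

/-- The product state `u ⊗ ψ`. -/
def tensor {m n : ℕ} (u : Bits m → ℂ) (ψ : Bits n → ℂ) : JointState m n :=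
  fun s => u s.1 * ψ s.2

/-- The basis state of the bit string `a`. -/
def ket {m : ℕ} (a : Bits m) : Bits m → ℂ := Pi.single a 1

/-- The all-zero basis state of `m` qubits. -/
def ketZero (m : ℕ) : Bits m → ℂ := ket (fun _ => false)

/-- Euclidean (Hilbert space) norm of a state vector. -/
def l2norm {m n : ℕ} (v : JointState m n) : ℝ := ‖WithLp.toLp 2 v‖

/-! ### Gates, circuits, and their cost -/

/-- A Hamiltonian term: a Hermitian generator on the state register, switched on
unconditionally (`control = none`) or controlled by the single answer qubit `j`
(`control = some j`). -/
structure Term (m n : ℕ) where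
  control : Option (Fin m)
  generator : Op n
  hermitian : generator.IsHermitian

/-- Is the control of a term active on the bit string `a`? -/
def Term.active {m n : ℕ} (T : Term m n) (a : Bits m) : Bool :=
  match T.control with
  | none => true
  | some j => a j

/-- The operator of a term on both registers: `I ⊗ G`, or `|1⟩⟨1|_j ⊗ G`. -/
def Term.toOp {m n : ℕ} (T : Term m n) : JointOp m n :=
  (Matrix.diagonal fun a : Bits m => if T.active a then (1 : ℂ) else 0) ⊗ₖ T.generator

/-- The gates: a Hadamard gate on one answer qubit, or a time evolution `exp (2πi ∑ T)` under
a sum of Hamiltonian terms, each controlled by at most one answer qubit. -/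
inductive Gate (m n : ℕ) where
  | hadamard (j : Fin m) : Gate m n
  | evolve (terms : List (Term m n)) : Gate m n

/-- The Hadamard gate on the answer qubit `j`. -/
def hadamardOp {m : ℕ} (j : Fin m) : Op m :=
  Matrix.of fun a b =>
    if ∀ k, k ≠ j → a k = b k then
      (if a j && b j then -1 else 1) / ((Real.sqrt 2 : ℝ) : ℂ)
    else 0

/-- The unitary that a gate implements. -/
def Gate.toOp {m n : ℕ} : Gate m n → JointOp m n
  | .hadamard j => hadamardOp j ⊗ₖ (1 : Op n)
  | .evolve terms =>
      NormedSpace.exp ((2 * (Real.pi : ℂ) * Complex.I) • (terms.map Term.toOp).sum)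

/-- Cost of a gate: a Hadamard gate costs one unit, a time evolution one unit for each of its
at most singly controlled Hamiltonian terms (the evolutions on the state register being
regarded as efficiently available, as in phase estimation). -/
def Gate.cost {m n : ℕ} : Gate m n → ℕ
  | .hadamard _ => 1
  | .evolve terms => terms.length

/-- A circuit is a list of gates, the head of the list being applied first. -/
abbrev Circuit (m n : ℕ) : Type := List (Gate m n)

/-- The unitary that a circuit implements. -/
def Circuit.toOp {m n : ℕ} (c : Circuit m n) : JointOp m n :=
  c.foldl (fun U g => g.toOp * U) 1

/-- The cost of a circuit. -/
def Circuit.cost {m n : ℕ} (c : Circuit m n) : ℕ := (c.map Gate.cost).sum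

/-! ### Phase estimation and gradient phase estimation -/

theorem isHermitian_real_smul {k : ℕ} {G : Op k} (h : G.IsHermitian) (r : ℝ) :
    ((r : ℂ) • G).IsHermitian := by
  unfold Matrix.IsHermitian at *
  rw [Matrix.conjTranspose_smul, h]
  simp

/-- The uncontrolled term `r G`. -/
def freeTerm {m n : ℕ} {G : Op n} (hG : G.IsHermitian) (r : ℝ) : Term m n :=
  ⟨none, (r : ℂ) • G, isHermitian_real_smul hG r⟩

/-- The term `2 ^ j r G` controlled by the answer qubit `j`. -/
def powerTerm {m n : ℕ} {G : Op n} (hG : G.IsHermitian) (r : ℝ) (j : Fin m) : Term m n :=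
  ⟨some j, ((2 ^ (j : ℕ) * r : ℝ) : ℂ) • G, isHermitian_real_smul hG _⟩

/-- A Hadamard gate on each answer qubit. -/
def hadamardLayer (m n : ℕ) : Circuit m n := List.ofFn fun j : Fin m => Gate.hadamard j

/-- Textbook quantum phase estimation of `V = exp (2πi r G)`, up to its final inverse Fourier
transform: Hadamard gates, then for each answer qubit `j` a `V ^ (2 ^ j)` controlled by it. -/
def qpe (m : ℕ) {n : ℕ} {G : Op n} (hG : G.IsHermitian) (r : ℝ) : Circuit m n :=
  hadamardLayer m n ++ List.ofFn fun j : Fin m => Gate.evolve [powerTerm hG r j]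

/-- The single time evolution used by gradient phase estimation: the Hamiltonian consists of the
free term `N/(WL) X` and of the terms `2 ^ j Δ / W` controlled by the answer qubits `j`. -/
def qgpeGate (m : ℕ) {n : ℕ} {X D : Op n} (hX : X.IsHermitian) (hD : D.IsHermitian)
    (N : ℕ) (W L : ℝ) : Gate m n :=
  Gate.evolve
    (freeTerm hX (N / (W * L)) :: List.ofFn fun j : Fin m => powerTerm hD (1 / W) j)

/-- Quantum gradient phase estimation, up to its final inverse Fourier transform. -/
def qgpe (m : ℕ) {n : ℕ} {X D : Op n} (hX : X.IsHermitian) (hD : D.IsHermitian)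
    (N : ℕ) (W L : ℝ) : Circuit m n :=
  hadamardLayer m n ++ [qgpeGate m hX hD N W L]

/-- The operator `∑ₐ |a⟩⟨a| ⊗ U a`, i.e. `U` controlled on the answer register. -/
def controlled {m n : ℕ} (U : Bits m → Op n) : JointOp m n :=
  Matrix.of fun s t => if s.1 = t.1 then U s.1 s.2 t.2 else 0

/-- The time evolution `exp (2πi N/(WL) (X + (L e / N) Δ))`. -/
def evolution {n : ℕ} (X D : Op n) (N : ℕ) (W L : ℝ) (e : ℕ) : Op n :=
  NormedSpace.exp ((2 * (Real.pi : ℂ) * Complex.I * ((N / (W * L) : ℝ) : ℂ)) •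
    (X + ((L * e / N : ℝ) : ℂ) • D))

/-- The phase `exp (2πi x)`. -/
def phase (x : ℝ) : ℂ := Complex.exp (2 * (Real.pi : ℂ) * Complex.I * (x : ℂ))

/-- The state `M^(-1/2) ∑ₐ exp (2πi f(a)) |a⟩`, `M = 2 ^ m`: the phase oracle of `f` applied to
the equal superposition of all bit strings. -/
def phaseState (m : ℕ) (f : ℕ → ℝ) : Bits m → ℂ :=
  fun a => phase (f (bitValue a)) / ((Real.sqrt (2 ^ m) : ℝ) : ℂ)

/-- The inverse quantum Fourier transform on `m` qubits. -/
def invQFT (m : ℕ) : Op m :=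
  Matrix.of fun b a =>
    phase (-(bitValue b * bitValue a / 2 ^ m : ℝ)) / ((Real.sqrt (2 ^ m) : ℝ) : ℂ)

/-- The inverse quantum Fourier transform of the answer register. -/
def readout {m n : ℕ} (v : JointState m n) : JointState m n :=
  (invQFT m ⊗ₖ (1 : Op n)) *ᵥ v

/-- The Fourier peak `M⁻¹ ∑_b ∑ₐ exp (-2πi a (b - M x) / M) |b⟩`, `M = 2 ^ m`, centred at `M x`. -/
def fourierPeak (m : ℕ) (x : ℝ) : Bits m → ℂ :=
  fun b => (∑ a : Bits m, phase (-(bitValue a * (bitValue b - 2 ^ m * x) / 2 ^ m : ℝ))) / 2 ^ m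

open Classical in
/-- Probability that measuring the answer register in the computational basis gives an outcome
`b` such that `b / 2 ^ m` is within `r` of `x`, as phases (that is, modulo 1). -/
def probWithin {m n : ℕ} (v : JointState m n) (x r : ℝ) : ℝ :=
  ∑ b : Bits m, if ∃ z : ℤ, |(bitValue b : ℝ) / 2 ^ m - x - z| ≤ r
    then ∑ y : Bits n, ‖v (b, y)‖ ^ 2 else 0

/-- `lam` is an eigenvalue of `X + t Δ` for every `t`, starts at `E`, and has derivative `g` at
`t = 0` with a second-order remainder. -/
def IsEigenvalueBranch {n : ℕ} (X D : Op n) (E : ℝ) (lam : ℝ → ℝ) (g : ℝ) : Prop :=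
  (∀ t : ℝ, Module.End.HasEigenvalue (Matrix.toLin' (X + (t : ℂ) • D)) (lam t : ℂ)) ∧
  lam 0 = E ∧ HasDerivAt lam g 0 ∧
  (fun t => lam t - (E + g * t)) =O[𝓝 0] fun t => t ^ 2

end QGPE

end

namespace QGPE

/-! ### Controlled operators -/

section Controlled

variable {m n : ℕ}

/-! The circuit identities rest on one remark: every evolution here is block diagonal over the
answer register, `∑ₐ |a⟩⟨a| ⊗ U a`, and `exp` acts blockwise (`exp_controlled`). In block `a` the
weights `2 ^ j` of the set bits add up to the integer `bitValue a`, which turns the sum of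
controlled terms into `X + (Lε/N) Δ`.

For an eigenvector `p`, no analytic perturbation theory is needed. With `g = ⟨p, Δp⟩`, the
hypothesis makes `gp - Δp` orthogonal to the whole `E`-eigenspace, so `(X - E) q = gp - Δp` is
solvable with `q ⊥ p` (`exists_firstOrder_correction`). Then `p + tq` is an approximate eigenvector
of `X + tΔ` at `E + gt`, with residual `t² r`, `r = Δq - gq`. Diagonalization gives two
consequences: some eigenvalue lies within the residual of `E + gt`, and `exp (is(X + tΔ))`
multiplies `p + tq` by a phase up to `|s|` times the residual (`exists_eigenvalueBranch`). For `s =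
2πN/(WL)` and `t = Lε/N` the total error `|t| + |s| t²` is linear in `L`. Every error constant is a
multiple of `κ = 2‖q‖ + ‖r‖`, and `q = 0` when `Δp = gp`, whence exactness.

After the Fourier transform the amplitudes are geometric sums. If `d` is the fractional part of `Mx`
and `d ≠ 0`, the two outcomes next to `Mx` have total probability at least `sin²(πd)/π² · (1/d² +
1/(1-d)²) ≥ 8/π²`. Outcome probabilities are Lipschitz in the state, so the `O(L)` error carries
over. -/

theorem controlled_eq_reindex (U : Bits m → Op n) :
    controlled U = (Matrix.reindexAlgEquiv ℂ ℂ (Equiv.prodComm (Bits n) (Bits m)))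
      (Matrix.blockDiagonal U) := by
  ext ⟨a, x⟩ ⟨b, y⟩
  simp [controlled, Matrix.blockDiagonal_apply]

theorem controlled_mul (U V : Bits m → Op n) :
    controlled U * controlled V = controlled (fun a => U a * V a) := by
  simp_rw [controlled_eq_reindex, ← map_mul, Matrix.blockDiagonal_mul]

theorem controlled_one : controlled (fun _ : Bits m => (1 : Op n)) = 1 := by
  rw [controlled_eq_reindex, show (fun _ : Bits m => (1 : Op n)) = 1 from rfl,
    Matrix.blockDiagonal_one, map_one]

theorem controlled_add (U V : Bits m → Op n) :
    controlled U + controlled V = controlled (fun a => U a + V a) := by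
  simp_rw [controlled_eq_reindex, ← map_add, ← Matrix.blockDiagonal_add]
  rfl

theorem controlled_zero : controlled (fun _ : Bits m => (0 : Op n)) = 0 := by
  ext s t
  simp [controlled]

theorem controlled_smul (c : ℂ) (U : Bits m → Op n) :
    c • controlled U = controlled (fun a => c • U a) := by
  ext s t
  simp [controlled]

theorem controlled_const (U : Op n) :
    controlled (fun _ : Bits m => U) = (1 : Op m) ⊗ₖ U := by
  ext ⟨a, x⟩ ⟨b, y⟩
  simp [controlled, Matrix.kroneckerMap_apply, Matrix.one_apply]

theorem diagonal_kronecker_eq_controlled (d : Bits m → ℂ) (U : Op n) :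
    (Matrix.diagonal d) ⊗ₖ U = controlled (fun a => d a • U) := by
  ext ⟨a, x⟩ ⟨b, y⟩
  simp [controlled, Matrix.kroneckerMap_apply, Matrix.diagonal_apply]

theorem exp_pi_apply {ι 𝔸 : Type*} [Finite ι] [NormedRing 𝔸] [NormedAlgebra ℂ 𝔸]
    [FiniteDimensional ℂ 𝔸] (x : ι → 𝔸) (i : ι) :
    NormedSpace.exp x i = NormedSpace.exp (x i) := by
  have : CompleteSpace 𝔸 := FiniteDimensional.complete ℂ 𝔸
  have : NormedAlgebra ℚ 𝔸 := NormedAlgebra.restrictScalars ℚ ℂ 𝔸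
  exact Pi.coe_exp x i

/-- Algebra maps out of a finite-dimensional algebra are automatically continuous; applied to the
reindexing isomorphism. -/
theorem map_exp_of_finiteDimensional {𝔸 𝔹 : Type*} [NormedRing 𝔸] [NormedAlgebra ℂ 𝔸]
    [FiniteDimensional ℂ 𝔸] [NormedRing 𝔹] [NormedAlgebra ℂ 𝔹] (f : 𝔸 →ₐ[ℂ] 𝔹) (x : 𝔸) :
    f (NormedSpace.exp x) = NormedSpace.exp (f x) := by
  have : CompleteSpace 𝔸 := FiniteDimensional.complete ℂ 𝔸
  have : NormedAlgebra ℚ 𝔸 := NormedAlgebra.restrictScalars ℚ ℂ 𝔸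
  have : NormedAlgebra ℚ 𝔹 := NormedAlgebra.restrictScalars ℚ ℂ 𝔹
  exact NormedSpace.map_exp f (LinearMap.continuous_of_finiteDimensional f.toLinearMap) x

open scoped Matrix.Norms.Operator in
-- Swapping the two registers makes the operator literally block diagonal, and the swap is an
-- algebra isomorphism, so it commutes with `exp`.
theorem exp_controlled (H : Bits m → Op n) :
    NormedSpace.exp (controlled H) = controlled (fun a => NormedSpace.exp (H a)) := by
  have h : (fun a => NormedSpace.exp (H a)) = NormedSpace.exp H := by
    funext a
    exact (exp_pi_apply H a).symm
  rw [h, controlled_eq_reindex, controlled_eq_reindex, ← Matrix.exp_blockDiagonal]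
  exact (map_exp_of_finiteDimensional (Matrix.reindexAlgEquiv ℂ ℂ
    (Equiv.prodComm (Bits n) (Bits m))).toAlgHom _).symm

theorem controlled_mulVec_apply (U : Bits m → Op n) (v : JointState m n) (s : Bits m × Bits n) :
    (controlled U *ᵥ v) s = (U s.1 *ᵥ fun y => v (s.1, y)) s.2 := by
  obtain ⟨a, x⟩ := s
  simp [Matrix.mulVec, dotProduct, controlled, Fintype.sum_prod_type, ite_mul]

theorem kronecker_one_mulVec_tensor (A : Op m) (u : Bits m → ℂ) (ψ : Bits n → ℂ) :
    (A ⊗ₖ (1 : Op n)) *ᵥ tensor u ψ = tensor (A *ᵥ u) ψ := by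
  ext ⟨a, x⟩
  simp [Matrix.mulVec, dotProduct, tensor, Matrix.kroneckerMap_apply, Fintype.sum_prod_type,
    Matrix.one_apply, mul_assoc, Finset.sum_mul]

theorem list_sum_controlled (l : List (Bits m → Op n)) :
    (l.map controlled).sum = controlled (fun a => (l.map fun U => U a).sum) := by
  induction l with
  | nil => simp [controlled_zero]
  | cons U l ih => simp [ih, controlled_add]

end Controlled

/-! ### Circuits -/

section Circuits

variable {m n : ℕ}

theorem Circuit.toOp_append_singleton (c : Circuit m n) (g : Gate m n) :
    Circuit.toOp (c ++ [g]) = g.toOp * Circuit.toOp c := by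
  simp [Circuit.toOp]

theorem Circuit.toOp_nil : Circuit.toOp ([] : Circuit m n) = 1 := rfl

theorem Circuit.toOp_append (c d : Circuit m n) :
    Circuit.toOp (c ++ d) = Circuit.toOp d * Circuit.toOp c := by
  induction d using List.reverseRecOn with
  | nil => simp [Circuit.toOp_nil]
  | append_singleton d g ih =>
    rw [← List.append_assoc, Circuit.toOp_append_singleton, Circuit.toOp_append_singleton, ih,
      mul_assoc]

theorem Circuit.cost_append (c d : Circuit m n) :
    Circuit.cost (c ++ d) = Circuit.cost c + Circuit.cost d := by
  simp [Circuit.cost]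

theorem cost_hadamardLayer : Circuit.cost (hadamardLayer m n) = m := by
  simp [Circuit.cost, hadamardLayer, List.map_ofFn, Function.comp_def, Gate.cost]

theorem cost_qpe {G : Op n} (hG : G.IsHermitian) (r : ℝ) :
    Circuit.cost (qpe m hG r) = m + m := by
  rw [qpe, Circuit.cost_append, cost_hadamardLayer]
  simp [Circuit.cost, List.map_ofFn, Function.comp_def, Gate.cost]

theorem cost_qgpe {X D : Op n} (hX : X.IsHermitian) (hD : D.IsHermitian) (N : ℕ) (W L : ℝ) :
    Circuit.cost (qgpe m hX hD N W L) = m + m + 1 := by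
  rw [qgpe, Circuit.cost_append, cost_hadamardLayer]
  simp [Circuit.cost, qgpeGate, Gate.cost]
  ring

/-- A Hadamard layer acts on the answer register only. -/
theorem exists_toOp_hadamard_eq (l : List (Fin m)) :
    ∃ A : Op m, Circuit.toOp (l.map (Gate.hadamard (n := n))) = A ⊗ₖ (1 : Op n) := by
  induction l using List.reverseRecOn with
  | nil => exact ⟨1, by simp [Circuit.toOp_nil]⟩
  | append_singleton l j ih =>
    obtain ⟨A, hA⟩ := ih
    refine ⟨hadamardOp j * A, ?_⟩
    rw [List.map_append, List.map_singleton, Circuit.toOp_append_singleton, hA, Gate.toOp,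
      ← Matrix.mul_kronecker_mul, one_mul]

theorem hadamardLayer_eq_map : hadamardLayer m n = (List.finRange m).map Gate.hadamard := by
  rw [hadamardLayer, List.ofFn_eq_map]

theorem commute_hadamardLayer (U : Op n) :
    Commute (Circuit.toOp (hadamardLayer m n)) ((1 : Op m) ⊗ₖ U) := by
  obtain ⟨A, hA⟩ := exists_toOp_hadamard_eq (n := n) (List.finRange m)
  rw [hadamardLayer_eq_map, hA, Commute, SemiconjBy, ← Matrix.mul_kronecker_mul,
    ← Matrix.mul_kronecker_mul]
  simp

/-- Generalized to a partial layer for induction: the state is uniform on the strings supported in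
`l`. Distinctness matters, since a repeated Hadamard gate would undo itself. -/
theorem hadamards_mulVec_ketZero (l : List (Fin m)) (hl : l.Nodup) (ψ : Bits n → ℂ) :
    Circuit.toOp (l.map Gate.hadamard) *ᵥ tensor (ketZero m) ψ =
      tensor (fun a => if ∀ k, k ∉ l → a k = false then
        (1 / ((Real.sqrt 2 : ℝ) : ℂ)) ^ l.length else 0) ψ := by
  induction l using List.reverseRecOn with
  | nil =>
    ext ⟨a, x⟩
    simp [Circuit.toOp_nil, tensor, ketZero, ket, Pi.single_apply, funext_iff]
  | append_singleton l j ih =>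
    have hl' : l.Nodup ∧ j ∉ l := by
      rw [List.nodup_append] at hl
      exact ⟨hl.1, fun h => hl.2.2 j h j (by simp) rfl⟩
    rw [List.map_append, List.map_singleton, Circuit.toOp_append_singleton,
      ← Matrix.mulVec_mulVec, ih hl'.1, Gate.toOp, kronecker_one_mulVec_tensor]
    congr 1
    ext a
    simp only [Matrix.mulVec, dotProduct, hadamardOp, Matrix.of_apply]
    -- Qubit `j` is still untouched, so only strings with bit `j` cleared have nonzero amplitude;
    -- just one of them agrees with `a` off `j`.
    rw [Finset.sum_eq_single (Function.update a j false)]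
    · have h1 : ∀ k, k ≠ j → a k = Function.update a j false k := fun k hk => by
        rw [Function.update_of_ne hk]
      have h2 : (∀ k, k ∉ l → Function.update a j false k = false) ↔
          ∀ k, k ∉ l ++ [j] → a k = false := by
        constructor
        · intro h k hk
          simp only [List.mem_append, List.mem_singleton, not_or] at hk
          simpa [Function.update_of_ne hk.2] using h k hk.1
        · intro h k hk
          rcases eq_or_ne k j with rfl | hkj
          · simp
          · rw [Function.update_of_ne hkj]
            exact h k (by simp [hk, hkj])
      rw [if_pos h1]
      simp only [h2, Function.update_self, Bool.and_false, Bool.false_eq_true, if_false, List.length_append,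
        List.length_singleton, pow_succ]
      split_ifs <;> simp [mul_comm]
    · intro b _ hb
      by_cases h1 : ∀ k, k ≠ j → a k = b k
      · rw [if_neg (c := ∀ k, k ∉ l → b k = false), mul_zero]
        intro h
        refine hb (funext fun k => ?_)
        rcases eq_or_ne k j with rfl | hkj
        · rw [Function.update_self]
          exact h _ hl'.2
        · rw [Function.update_of_ne hkj, h1 k hkj]
      · rw [if_neg h1, zero_mul]
    · simp

theorem ofReal_sqrt_two_pow (m : ℕ) :
    ((Real.sqrt (2 ^ m) : ℝ) : ℂ) = ((Real.sqrt 2 : ℝ) : ℂ) ^ m := by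
  rw [← Complex.ofReal_pow]
  congr 1
  rw [Real.sqrt_eq_iff_mul_self_eq (by positivity) (by positivity), ← mul_pow]
  simp

theorem hadamardLayer_mulVec_ketZero (ψ : Bits n → ℂ) :
    Circuit.toOp (hadamardLayer m n) *ᵥ tensor (ketZero m) ψ =
      tensor (fun _ => 1 / ((Real.sqrt (2 ^ m) : ℝ) : ℂ)) ψ := by
  rw [hadamardLayer_eq_map, hadamards_mulVec_ketZero _ (List.nodup_finRange m)]
  congr 1
  ext a
  simp [ofReal_sqrt_two_pow]

end Circuits

/-! ### Exponentials and eigenvectors -/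

theorem pow_mulVec_of_mulVec_eq_smul {ι : Type*} [Fintype ι] [DecidableEq ι] {A : Matrix ι ι ℂ}
    {v : ι → ℂ} {μ : ℂ} (h : A *ᵥ v = μ • v) (k : ℕ) : (A ^ k) *ᵥ v = μ ^ k • v := by
  induction k with
  | zero => simp
  | succ k ih =>
    rw [pow_succ, ← Matrix.mulVec_mulVec, h, Matrix.mulVec_smul, ih, smul_smul, pow_succ, mul_comm]

open scoped Matrix.Norms.Operator in
-- Compare the two exponential series term by term, `B ↦ B *ᵥ v` being linear and continuous.
theorem exp_mulVec_of_mulVec_eq_smul {ι : Type*} [Fintype ι] [DecidableEq ι] {A : Matrix ι ι ℂ}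
    {v : ι → ℂ} {μ : ℂ} (h : A *ᵥ v = μ • v) :
    NormedSpace.exp A *ᵥ v = Complex.exp μ • v := by
  have h1 := NormedSpace.exp_series_hasSum_exp' (𝕂 := ℂ) A
  have h2 := h1.map ((Matrix.mulVecBilin ℂ ℂ).flip v)
    (LinearMap.continuous_of_finiteDimensional ((Matrix.mulVecBilin ℂ ℂ).flip v))
  have h3 := (NormedSpace.exp_series_hasSum_exp' (𝕂 := ℂ) μ).smul_const v
  rw [Complex.exp_eq_exp_ℂ]
  refine h2.unique ?_
  convert h3 using 2 with k
  simp [pow_mulVec_of_mulVec_eq_smul h, smul_smul]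

/-! ### The time evolutions -/

section Evolutions

variable {m n : ℕ}

theorem natCast_bitValue {R : Type*} [CommSemiring R] (a : Bits m) :
    (bitValue a : R) = ∑ j : Fin m, if a j then (2 : R) ^ (j : ℕ) else 0 := by
  simp [bitValue]

theorem freeTerm_toOp {G : Op n} (hG : G.IsHermitian) (r : ℝ) :
    (freeTerm (m := m) hG r).toOp = controlled (fun _ => (r : ℂ) • G) := by
  rw [Term.toOp, diagonal_kronecker_eq_controlled]
  simp [freeTerm, Term.active]

theorem powerTerm_toOp {G : Op n} (hG : G.IsHermitian) (r : ℝ) (j : Fin m) :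
    (powerTerm hG r j).toOp =
      controlled (fun a => ((if a j then (2 : ℂ) ^ (j : ℕ) else 0) * (r : ℂ)) • G) := by
  rw [Term.toOp, diagonal_kronecker_eq_controlled]
  congr 1
  ext1 a
  cases h : a j <;> simp [powerTerm, Term.active, h]

theorem qgpeGate_toOp {X D : Op n} (hX : X.IsHermitian) (hD : D.IsHermitian) {N : ℕ} {W L : ℝ}
    (hN : 0 < N) (hW : 0 < W) (hL : 0 < L) :
    (qgpeGate m hX hD N W L).toOp =
      controlled (fun a => evolution X D N W L (bitValue a)) := by
  have hN' : (N : ℂ) ≠ 0 := by exact_mod_cast hN.ne'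
  have hW' : (W : ℂ) ≠ 0 := by exact_mod_cast hW.ne'
  have hL' : (L : ℂ) ≠ 0 := by exact_mod_cast hL.ne'
  rw [qgpeGate, Gate.toOp, List.map_cons, List.sum_cons, freeTerm_toOp, List.map_ofFn]
  simp only [Function.comp_def, powerTerm_toOp]
  rw [← Function.comp_def controlled, ← List.map_ofFn, list_sum_controlled, controlled_add,
    controlled_smul, exp_controlled]
  congr 1
  ext1 a
  rw [evolution]
  congr 1
  rw [List.map_ofFn, List.sum_ofFn]
  simp only [Function.comp_def]
  rw [← Finset.sum_smul, ← Finset.sum_mul, ← natCast_bitValue, smul_add, smul_add, smul_smul,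
    smul_smul, smul_smul]
  congr 2
  push_cast
  field_simp

/-- Within a block all generators are multiples of `G`, so they commute and the exponents add. -/
theorem evolve_powerTerms_toOp {G : Op n} (hG : G.IsHermitian) (r : ℝ) (l : List (Fin m)) :
    Circuit.toOp (l.map fun j => Gate.evolve [powerTerm hG r j]) =
      controlled (fun a => NormedSpace.exp ((2 * (Real.pi : ℂ) * Complex.I *
        ((l.map fun j => if a j then (2 : ℂ) ^ (j : ℕ) else 0).sum * (r : ℂ))) • G)) := by
  induction l using List.reverseRecOn with
  | nil => simp [Circuit.toOp_nil, controlled_one]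
  | append_singleton l j ih =>
    rw [List.map_append, List.map_singleton, Circuit.toOp_append_singleton, ih, Gate.toOp,
      List.map_singleton, List.sum_singleton, powerTerm_toOp, controlled_smul, exp_controlled,
      controlled_mul]
    congr 1
    ext1 a
    rw [smul_smul, ← Matrix.exp_add_of_commute _ _
      (((Commute.refl G).smul_left _).smul_right _), ← add_smul, List.map_append,
      List.sum_append, List.map_singleton, List.sum_singleton]
    congr 2
    ring

theorem qpe_toOp {G : Op n} (hG : G.IsHermitian) (r : ℝ) :
    Circuit.toOp (qpe m hG r) =
      controlled (fun a => NormedSpace.exp ((2 * (Real.pi : ℂ) * Complex.I *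
        (bitValue a * (r : ℂ))) • G)) * Circuit.toOp (hadamardLayer m n) := by
  rw [qpe, Circuit.toOp_append, List.ofFn_eq_map, evolve_powerTerms_toOp]
  simp only [natCast_bitValue, ← List.ofFn_eq_map, List.sum_ofFn]

theorem qgpe_toOp {X D : Op n} (hX : X.IsHermitian) (hD : D.IsHermitian) {N : ℕ} {W L : ℝ}
    (hN : 0 < N) (hW : 0 < W) (hL : 0 < L) :
    Circuit.toOp (qgpe m hX hD N W L) =
      controlled (fun a => evolution X D N W L (bitValue a)) *
        Circuit.toOp (hadamardLayer m n) := by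
  rw [qgpe, Circuit.toOp_append_singleton, qgpeGate_toOp hX hD hN hW hL]

theorem controlled_mul_hadamardLayer_mulVec (U : Bits m → Op n) (ψ : Bits n → ℂ) :
    (controlled U * Circuit.toOp (hadamardLayer m n)) *ᵥ tensor (ketZero m) ψ =
      fun s => (1 / ((Real.sqrt (2 ^ m) : ℝ) : ℂ)) * (U s.1 *ᵥ ψ) s.2 := by
  rw [← Matrix.mulVec_mulVec, hadamardLayer_mulVec_ketZero]
  ext s
  rw [controlled_mulVec_apply]
  change (U s.1 *ᵥ ((1 / ((Real.sqrt (2 ^ m) : ℝ) : ℂ)) • ψ)) s.2 = _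
  rw [Matrix.mulVec_smul, Pi.smul_apply, smul_eq_mul]

theorem qgpe_mulVec {X D : Op n} (hX : X.IsHermitian) (hD : D.IsHermitian) {N : ℕ} {W L : ℝ}
    (hN : 0 < N) (hW : 0 < W) (hL : 0 < L) (ψ : Bits n → ℂ) :
    Circuit.toOp (qgpe m hX hD N W L) *ᵥ tensor (ketZero m) ψ =
      fun s => (1 / ((Real.sqrt (2 ^ m) : ℝ) : ℂ)) *
        (evolution X D N W L (bitValue s.1) *ᵥ ψ) s.2 := by
  rw [qgpe_toOp hX hD hN hW hL, controlled_mul_hadamardLayer_mulVec]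

theorem evolution_eq_mul_of_commute {X D : Op n} (h : Commute X D) {N : ℕ} {W L : ℝ}
    (hN : 0 < N) (hW : 0 < W) (hL : 0 < L) (e : ℕ) :
    evolution X D N W L e =
      NormedSpace.exp ((2 * (Real.pi : ℂ) * Complex.I * (e * ((1 / W : ℝ) : ℂ))) • D) *
        evolution X D N W L 0 := by
  have hN' : (N : ℂ) ≠ 0 := by exact_mod_cast hN.ne'
  have hW' : (W : ℂ) ≠ 0 := by exact_mod_cast hW.ne'
  have hL' : (L : ℂ) ≠ 0 := by exact_mod_cast hL.ne'
  have h0 : evolution X D N W L 0 = NormedSpace.exp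
      ((2 * (Real.pi : ℂ) * Complex.I * ((N / (W * L) : ℝ) : ℂ)) • X) := by
    simp [evolution]
  rw [h0, ← Matrix.exp_add_of_commute _ _ ((h.symm.smul_left _).smul_right _), evolution,
    smul_add, smul_smul, add_comm]
  congr 3
  push_cast
  field_simp

/-- Each block splits off the same free evolution, which acts on the state register alone and so
passes through the Hadamard layer. -/
theorem qgpe_toOp_of_commute {X D : Op n} (hX : X.IsHermitian) (hD : D.IsHermitian)
    (h : Commute X D) {N : ℕ} {W L : ℝ} (hN : 0 < N) (hW : 0 < W) (hL : 0 < L) :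
    Circuit.toOp (qgpe m hX hD N W L) =
      Circuit.toOp (qpe m hD (1 / W)) * ((1 : Op m) ⊗ₖ evolution X D N W L 0) := by
  rw [qgpe_toOp hX hD hN hW hL, qpe_toOp, mul_assoc, (commute_hadamardLayer _).eq, ← mul_assoc,
    ← controlled_const, controlled_mul]
  congr 2
  ext1 a
  exact evolution_eq_mul_of_commute h hN hW hL _

theorem qpe_mulVec_of_eigenvector {G : Op n} (hG : G.IsHermitian) {r x : ℝ} {ψ : Bits n → ℂ}
    (h : ((r : ℂ) • G) *ᵥ ψ = (x : ℂ) • ψ) :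
    Circuit.toOp (qpe m hG r) *ᵥ tensor (ketZero m) ψ =
      tensor (phaseState m fun e => e * x) ψ := by
  rw [qpe_toOp, controlled_mul_hadamardLayer_mulVec]
  ext s
  have h1 : ((2 * (Real.pi : ℂ) * Complex.I * (bitValue s.1 * (r : ℂ))) • G) *ᵥ ψ =
      (2 * (Real.pi : ℂ) * Complex.I * ((bitValue s.1 * x : ℝ) : ℂ)) • ψ := by
    rw [← mul_assoc, ← smul_smul, Matrix.smul_mulVec, h, smul_smul]
    push_cast
    ring_nf
  rw [exp_mulVec_of_mulVec_eq_smul h1]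
  simp only [tensor, phaseState, phase, Pi.smul_apply, smul_eq_mul]
  ring

end Evolutions

/-! ### Spectral estimates for Hermitian matrices -/

section Spectral

theorem star_dotProduct_eq_inner {κ : Type*} [Fintype κ] (x y : κ → ℂ) :
    star x ⬝ᵥ y = inner ℂ (WithLp.toLp 2 x) (WithLp.toLp 2 y) := by
  rw [EuclideanSpace.inner_eq_star_dotProduct, dotProduct_comm]

variable {ι : Type*} [Fintype ι] [DecidableEq ι]

/-- Parseval in a basis that diagonalizes `B`. -/
theorem norm_sq_mulVec_of_eigenbasis (b : OrthonormalBasis ι ℂ (EuclideanSpace ℂ ι))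
    {B : Matrix ι ι ℂ} {f : ι → ℂ} (hB : ∀ i, B *ᵥ (b i).ofLp = f i • (b i).ofLp) (v : ι → ℂ) :
    ‖WithLp.toLp 2 (B *ᵥ v)‖ ^ 2 = ∑ i, ‖f i‖ ^ 2 * ‖b.repr (WithLp.toLp 2 v) i‖ ^ 2 := by
  have h1 : WithLp.toLp 2 (B *ᵥ v) =
      ∑ i, (f i * b.repr (WithLp.toLp 2 v) i) • b i := by
    have h2 : Matrix.toLpLin 2 2 B (WithLp.toLp 2 v) = WithLp.toLp 2 (B *ᵥ v) := rfl
    rw [← h2]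
    conv_lhs => rw [← b.sum_repr (WithLp.toLp 2 v)]
    rw [map_sum]
    refine Finset.sum_congr rfl fun i _ => ?_
    rw [map_smul, mul_comm, ← smul_smul]
    congr 1
    rw [Matrix.toLpLin_apply, hB]
    rfl
  rw [h1, ← b.repr.norm_map, EuclideanSpace.norm_sq_eq]
  refine Finset.sum_congr rfl fun i _ => ?_
  rw [← mul_pow, ← norm_mul]
  congr 2
  simp [map_sum, OrthonormalBasis.repr_self, Finset.sum_apply, Pi.single_apply]

/-- For simultaneously diagonal operators, norm comparison reduces to comparing eigenvalues. The
nearest-eigenvalue, residual and contraction estimates below are all instances. -/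
theorem norm_mulVec_le_of_eigenbasis (b : OrthonormalBasis ι ℂ (EuclideanSpace ℂ ι))
    {A B : Matrix ι ι ℂ} {f g : ι → ℂ} {c : ℝ} (hc : 0 ≤ c)
    (hA : ∀ i, A *ᵥ (b i).ofLp = f i • (b i).ofLp)
    (hB : ∀ i, B *ᵥ (b i).ofLp = g i • (b i).ofLp) (h : ∀ i, ‖f i‖ ≤ c * ‖g i‖) (v : ι → ℂ) :
    ‖WithLp.toLp 2 (A *ᵥ v)‖ ≤ c * ‖WithLp.toLp 2 (B *ᵥ v)‖ := by
  refine le_of_sq_le_sq ?_ (by positivity)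
  rw [mul_pow, norm_sq_mulVec_of_eigenbasis b hA, norm_sq_mulVec_of_eigenbasis b hB,
    Finset.mul_sum]
  refine Finset.sum_le_sum fun i _ => ?_
  rw [← mul_assoc, ← mul_pow c]
  exact mul_le_mul_of_nonneg_right (pow_le_pow_left₀ (norm_nonneg _) (h i) 2) (sq_nonneg _)

theorem mulVec_eigenvectorBasis_complex {A : Matrix ι ι ℂ} (hA : A.IsHermitian) (i : ι) :
    A *ᵥ (hA.eigenvectorBasis i).ofLp =
      (hA.eigenvalues i : ℂ) • (hA.eigenvectorBasis i).ofLp := by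
  rw [hA.mulVec_eigenvectorBasis]
  ext j
  simp

theorem sub_smul_one_mulVec_eigenvectorBasis {A : Matrix ι ι ℂ} (hA : A.IsHermitian) (μ : ℝ)
    (i : ι) :
    (A - (μ : ℂ) • (1 : Matrix ι ι ℂ)) *ᵥ (hA.eigenvectorBasis i).ofLp =
      ((hA.eigenvalues i - μ : ℝ) : ℂ) • (hA.eigenvectorBasis i).ofLp := by
  rw [Matrix.sub_mulVec, mulVec_eigenvectorBasis_complex, Matrix.smul_mulVec, Matrix.one_mulVec,
    ← sub_smul]
  simp

theorem norm_toLp_eq_one {κ : Type*} [Fintype κ] {p : κ → ℂ} (hp : star p ⬝ᵥ p = 1) :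
    ‖WithLp.toLp 2 p‖ = 1 := by
  have h : ‖WithLp.toLp 2 p‖ ^ 2 = 1 := by
    rw [← Complex.ofReal_inj, ← Complex.coe_algebraMap, map_pow]
    rw [star_dotProduct_eq_inner, inner_self_eq_norm_sq_to_K] at hp
    simpa using hp
  nlinarith [norm_nonneg (WithLp.toLp 2 p)]

/-- The eigenvalue of a Hermitian matrix closest to `μ` is at distance at most the residual of
any approximate eigenvector. -/
theorem exists_hasEigenvalue_near [Nonempty ι] {A : Matrix ι ι ℂ} (hA : A.IsHermitian) (μ : ℝ) :
    ∃ l : ℝ, Module.End.HasEigenvalue (Matrix.toLin' A) (l : ℂ) ∧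
      ∀ v : ι → ℂ, |l - μ| * ‖WithLp.toLp 2 v‖ ≤ ‖WithLp.toLp 2 (A *ᵥ v - (μ : ℂ) • v)‖ := by
  -- For the eigenvalue nearest to `μ`, the scalar `λᵢ - μ` is dominated by `A - μ` in the
  -- eigenbasis, for all `v` at once.
  obtain ⟨i, hi⟩ := Finite.exists_min fun i => |hA.eigenvalues i - μ|
  refine ⟨hA.eigenvalues i, ?_, fun v => ?_⟩
  · refine Module.End.hasEigenvalue_of_hasEigenvector
      (x := (hA.eigenvectorBasis i).ofLp) ⟨?_, ?_⟩
    · rw [Module.End.mem_eigenspace_iff, Matrix.toLin'_apply, mulVec_eigenvectorBasis_complex]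
    · intro h
      exact hA.eigenvectorBasis.orthonormal.ne_zero i ((WithLp.ofLp_eq_zero 2).1 h)
  · have h := norm_mulVec_le_of_eigenbasis hA.eigenvectorBasis zero_le_one
      (A := ((hA.eigenvalues i - μ : ℝ) : ℂ) • (1 : Matrix ι ι ℂ))
      (f := fun _ => ((hA.eigenvalues i - μ : ℝ) : ℂ))
      (fun j => by rw [Matrix.smul_mulVec, Matrix.one_mulVec])
      (sub_smul_one_mulVec_eigenvectorBasis hA μ)
      (fun j => by simpa only [one_mul, Complex.norm_real, Real.norm_eq_abs] using hi j) v
    rwa [Matrix.smul_mulVec, Matrix.one_mulVec, WithLp.toLp_smul, norm_smul, Complex.norm_real,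
      Real.norm_eq_abs, one_mul, Matrix.sub_mulVec, Matrix.smul_mulVec, Matrix.one_mulVec] at h

theorem norm_exp_I_mul_sub_exp_I_mul_le (x y : ℝ) :
    ‖Complex.exp (Complex.I * x) - Complex.exp (Complex.I * y)‖ ≤ |x - y| := by
  have h : Complex.exp (Complex.I * x) - Complex.exp (Complex.I * y) =
      Complex.exp (Complex.I * y) * (Complex.exp (Complex.I * (x - y : ℝ)) - 1) := by
    rw [mul_sub, ← Complex.exp_add, mul_one]
    congr 2
    push_cast
    ring
  rw [h, norm_mul, mul_comm Complex.I (y : ℂ), Complex.norm_exp_ofReal_mul_I, one_mul]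
  exact Real.norm_exp_I_mul_ofReal_sub_one_le

/-- An approximate eigenvector evolves by the corresponding phase, up to the residual times the
evolution time. -/
theorem norm_exp_mulVec_sub_le {A : Matrix ι ι ℂ} (hA : A.IsHermitian) (s μ : ℝ) (v : ι → ℂ) :
    ‖WithLp.toLp 2 (NormedSpace.exp ((Complex.I * (s : ℂ)) • A) *ᵥ v -
      Complex.exp (Complex.I * (s * μ : ℝ)) • v)‖ ≤
      |s| * ‖WithLp.toLp 2 (A *ᵥ v - (μ : ℂ) • v)‖ := by
  have h := norm_mulVec_le_of_eigenbasis hA.eigenvectorBasis (abs_nonneg s)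
    (A := NormedSpace.exp ((Complex.I * (s : ℂ)) • A) -
      Complex.exp (Complex.I * (s * μ : ℝ)) • (1 : Matrix ι ι ℂ))
    (f := fun i => Complex.exp (Complex.I * (s * hA.eigenvalues i : ℝ)) -
      Complex.exp (Complex.I * (s * μ : ℝ))) (fun i => ?_)
    (sub_smul_one_mulVec_eigenvectorBasis hA μ) (fun i => ?_) v
  · rwa [Matrix.sub_mulVec, Matrix.smul_mulVec, Matrix.one_mulVec, Matrix.sub_mulVec,
      Matrix.smul_mulVec, Matrix.one_mulVec] at h
  · have h1 : ((Complex.I * (s : ℂ)) • A) *ᵥ (hA.eigenvectorBasis i).ofLp =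
        (Complex.I * (s * hA.eigenvalues i : ℝ)) • (hA.eigenvectorBasis i).ofLp := by
      rw [Matrix.smul_mulVec, mulVec_eigenvectorBasis_complex, smul_smul, mul_assoc]
      push_cast
      rfl
    rw [Matrix.sub_mulVec, exp_mulVec_of_mulVec_eq_smul h1, Matrix.smul_mulVec,
      Matrix.one_mulVec, sub_smul]
  · refine (norm_exp_I_mul_sub_exp_I_mul_le _ _).trans ?_
    rw [← mul_sub, abs_mul, Complex.norm_real, Real.norm_eq_abs]

theorem norm_exp_mulVec {A : Matrix ι ι ℂ} (hA : A.IsHermitian) (s : ℝ) (v : ι → ℂ) :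
    ‖WithLp.toLp 2 (NormedSpace.exp ((Complex.I * (s : ℂ)) • A) *ᵥ v)‖ ≤ ‖WithLp.toLp 2 v‖ := by
  have h := norm_mulVec_le_of_eigenbasis hA.eigenvectorBasis zero_le_one
    (A := NormedSpace.exp ((Complex.I * (s : ℂ)) • A)) (B := 1)
    (f := fun i => Complex.exp (Complex.I * (s * hA.eigenvalues i : ℝ)))
    (g := fun _ => 1) (fun i => ?_) (fun i => by simp) (fun i => ?_) v
  · simpa using h
  · refine exp_mulVec_of_mulVec_eq_smul ?_
    rw [Matrix.smul_mulVec, mulVec_eigenvectorBasis_complex, smul_smul, mul_assoc]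
    push_cast
    rfl
  · rw [mul_comm Complex.I, Complex.norm_exp_ofReal_mul_I]
    simp

/-! ### First-order perturbation of an eigenvector -/

/-- Fredholm alternative: the range of a Hermitian matrix is the orthogonal complement of its
kernel. -/
theorem exists_mulVec_eq_of_forall_star_dotProduct {T : Matrix ι ι ℂ} (hT : T.IsHermitian)
    {u : ι → ℂ} (h : ∀ k : ι → ℂ, T *ᵥ k = 0 → star k ⬝ᵥ u = 0) : ∃ q, T *ᵥ q = u := by
  have hs := Matrix.isSymmetric_toEuclideanLin_iff.mpr hT
  have hu : WithLp.toLp 2 u ∈ LinearMap.range (Matrix.toEuclideanLin T) := by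
    rw [← Submodule.orthogonal_orthogonal (LinearMap.range (Matrix.toEuclideanLin T)),
      hs.orthogonal_range, Submodule.mem_orthogonal]
    intro k hk
    have hk' : T *ᵥ k.ofLp = 0 := by
      have := congrArg WithLp.ofLp (LinearMap.mem_ker.1 hk)
      simpa [Matrix.toLpLin_apply] using this
    simpa [star_dotProduct_eq_inner] using h k.ofLp hk'
  obtain ⟨q, hq⟩ := hu
  exact ⟨q.ofLp, by simpa [Matrix.toLpLin_apply] using congrArg WithLp.ofLp hq⟩

/-- The first-order correction `q` of the eigenvector `p` under the perturbation `D`. -/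
theorem exists_firstOrder_correction {X D : Matrix ι ι ℂ} (hX : X.IsHermitian)
    (hD : D.IsHermitian) {E : ℝ} {p : ι → ℂ} (hp : X *ᵥ p = (E : ℂ) • p)
    (hp1 : star p ⬝ᵥ p = 1)
    (hdeg : ∀ q : ι → ℂ, X *ᵥ q = (E : ℂ) • q → star q ⬝ᵥ p = 0 → star q ⬝ᵥ (D *ᵥ p) = 0) :
    ∃ (g : ℝ) (q : ι → ℂ), star p ⬝ᵥ q = 0 ∧
      X *ᵥ q - (E : ℂ) • q = (g : ℂ) • p - D *ᵥ p ∧ (D *ᵥ p = (g : ℂ) • p → q = 0) := by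
  have hg : (((star p ⬝ᵥ (D *ᵥ p)).re : ℝ) : ℂ) = star p ⬝ᵥ (D *ᵥ p) :=
    Complex.ext (by simp) (by simpa using (hD.im_star_dotProduct_mulVec_self p).symm)
  set g : ℝ := (star p ⬝ᵥ (D *ᵥ p)).re
  -- Separated so that `q` is exactly zero here; this is the source of `C = 0` in the exact case.
  by_cases hDp : D *ᵥ p = (g : ℂ) • p
  · exact ⟨g, 0, by simp, by simp [hDp], fun _ => rfl⟩
  · have hT : (X - (E : ℂ) • (1 : Matrix ι ι ℂ)).IsHermitian := by
      refine hX.sub ?_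
      rw [Matrix.IsHermitian, Matrix.conjTranspose_smul]
      simp
    have hTv : ∀ v, (X - (E : ℂ) • (1 : Matrix ι ι ℂ)) *ᵥ v = X *ᵥ v - (E : ℂ) • v := fun v => by
      rw [Matrix.sub_mulVec, Matrix.smul_mulVec, Matrix.one_mulVec]
    obtain ⟨q, hq⟩ := exists_mulVec_eq_of_forall_star_dotProduct hT
      (u := (g : ℂ) • p - D *ᵥ p) fun k hk => by
        rw [hTv, sub_eq_zero] at hk
        set c := star k ⬝ᵥ p with hc
        -- Removing the `p`-component of the kernel vector `k` leaves an eigenvector orthogonal to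
        -- `p`, to which `hdeg` applies; the `p`-component itself is handled by the choice of `g`.
        have hk1 : X *ᵥ (k - star c • p) = (E : ℂ) • (k - star c • p) := by
          rw [Matrix.mulVec_sub, Matrix.mulVec_smul, hk, hp, smul_sub, smul_comm]
        have hk2 : star (k - star c • p) ⬝ᵥ p = 0 := by
          simp only [star_sub, star_smul, star_star, sub_dotProduct, smul_dotProduct, hp1, ← hc]
          simp
        have hk3 := hdeg _ hk1 hk2
        simp only [star_sub, star_smul, star_star, sub_dotProduct, smul_dotProduct, ← hg,
          smul_eq_mul] at hk3
        rw [dotProduct_sub, dotProduct_smul, smul_eq_mul, ← hc]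
        linear_combination -hk3
    rw [hTv] at hq
    -- Since `p` lies in the kernel of `X - E`, projecting it out of `q` keeps the equation.
    refine ⟨g, q - (star p ⬝ᵥ q) • p, ?_, ?_, fun h => absurd h hDp⟩
    · rw [dotProduct_sub, dotProduct_smul, hp1]
      simp
    · rw [Matrix.mulVec_sub, Matrix.mulVec_smul, hp, ← hq, smul_sub, smul_comm (E : ℂ)]
      abel

end Spectral

theorem isHermitian_add_smul {n : ℕ} {X D : Op n} (hX : X.IsHermitian) (hD : D.IsHermitian)
    (t : ℝ) : (X + (t : ℂ) • D).IsHermitian :=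
  hX.add (isHermitian_real_smul hD t)

/-- A second-order accurate eigenvalue branch through a nondegenerate direction, together with the
first-order accurate evolution of the unperturbed eigenvector. -/
theorem exists_eigenvalueBranch {n : ℕ} {X D : Op n} (hX : X.IsHermitian)
    (hD : D.IsHermitian) {E : ℝ} {p : Bits n → ℂ} (hp : X *ᵥ p = (E : ℂ) • p)
    (hp1 : star p ⬝ᵥ p = 1)
    (hdeg : ∀ q : Bits n → ℂ, X *ᵥ q = (E : ℂ) • q → star q ⬝ᵥ p = 0 →
      star q ⬝ᵥ (D *ᵥ p) = 0) :
    ∃ (lam : ℝ → ℝ) (g κ : ℝ), IsEigenvalueBranch X D E lam g ∧ 0 ≤ κ ∧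
      (D *ᵥ p = (g : ℂ) • p → κ = 0) ∧ (∀ t, |lam t - (E + g * t)| ≤ κ * t ^ 2) ∧
      ∀ s t : ℝ, ‖WithLp.toLp 2
        (NormedSpace.exp ((Complex.I * (s : ℂ)) • (X + (t : ℂ) • D)) *ᵥ p -
          Complex.exp (Complex.I * (s * (E + g * t) : ℝ)) • p)‖ ≤ κ * (|t| + |s| * t ^ 2) := by
  obtain ⟨g, q, hpq, hq, hq0⟩ := exists_firstOrder_correction hX hD hp hp1 hdeg
  set r : Bits n → ℂ := D *ᵥ q - (g : ℂ) • q with hr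
  -- The orders `1` and `t` cancel by the eigenvector equation and the equation for `q`.
  have hres : ∀ t : ℝ, (X + (t : ℂ) • D) *ᵥ (p + (t : ℂ) • q) -
      ((E + g * t : ℝ) : ℂ) • (p + (t : ℂ) • q) = ((t ^ 2 : ℝ) : ℂ) • r := fun t => by
    have h1 : X *ᵥ q = (E : ℂ) • q + ((g : ℂ) • p - D *ᵥ p) := by rw [← hq]; abel
    rw [Matrix.add_mulVec, Matrix.mulVec_add, Matrix.mulVec_smul, Matrix.smul_mulVec,
      Matrix.mulVec_add, Matrix.mulVec_smul, h1, hp, hr]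
    ext y
    simp only [Pi.add_apply, Pi.sub_apply, Pi.smul_apply, smul_eq_mul]
    push_cast
    ring
  -- Cauchy–Schwarz against `p`, using `q ⊥ p`.
  have hnorm : ∀ t : ℝ, 1 ≤ ‖WithLp.toLp 2 (p + (t : ℂ) • q)‖ := fun t => by
    have h1 : star p ⬝ᵥ (p + (t : ℂ) • q) = 1 := by
      rw [dotProduct_add, dotProduct_smul, hp1, hpq]
      simp
    have h2 := norm_toLp_eq_one hp1
    rw [star_dotProduct_eq_inner] at h1
    have h4 := norm_inner_le_norm (𝕜 := ℂ) (WithLp.toLp 2 p) (WithLp.toLp 2 (p + (t : ℂ) • q))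
    rwa [h1, h2, one_mul, norm_one] at h4
  have hev := fun t : ℝ => exists_hasEigenvalue_near (isHermitian_add_smul hX hD t) (E + g * t)
  -- The branch is chosen independently for each `t`, with no continuity imposed; its value and
  -- derivative at `0` come from `hbound` alone.
  choose lam hlam hlam' using hev
  set κ : ℝ := 2 * ‖WithLp.toLp 2 q‖ + ‖WithLp.toLp 2 r‖ with hκ
  have hκr : ‖WithLp.toLp 2 r‖ ≤ κ := by
    have := norm_nonneg (WithLp.toLp 2 q)
    linarith
  have hκq : 2 * ‖WithLp.toLp 2 q‖ ≤ κ := by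
    have := norm_nonneg (WithLp.toLp 2 r)
    linarith
  have hκ0 : 0 ≤ κ := by positivity
  have hbound : ∀ t, |lam t - (E + g * t)| ≤ κ * t ^ 2 := fun t => by
    have h1 := hlam' t (p + (t : ℂ) • q)
    rw [hres, WithLp.toLp_smul, norm_smul, Complex.norm_real, Real.norm_eq_abs,
      abs_of_nonneg (sq_nonneg t)] at h1
    calc |lam t - (E + g * t)| ≤ |lam t - (E + g * t)| * ‖WithLp.toLp 2 (p + (t : ℂ) • q)‖ :=
          le_mul_of_one_le_right (abs_nonneg _) (hnorm t)
      _ ≤ t ^ 2 * ‖WithLp.toLp 2 r‖ := h1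
      _ ≤ κ * t ^ 2 := by rw [mul_comm]; gcongr
  have hO : (fun t => lam t - (E + g * t)) =O[𝓝 0] fun t : ℝ => t ^ 2 :=
    IsBigO.of_bound κ (Eventually.of_forall fun t => by
      rw [Real.norm_eq_abs, Real.norm_eq_abs, abs_of_nonneg (sq_nonneg t)]
      exact hbound t)
  have h0 : lam 0 = E := by
    have := hbound 0
    simp only [mul_zero, add_zero, ne_eq, OfNat.ofNat_ne_zero, not_false_eq_true, zero_pow] at this
    exact sub_eq_zero.1 (abs_eq_zero.1 (le_antisymm this (abs_nonneg _)))
  refine ⟨lam, g, κ, ⟨hlam, h0, ?_, hO⟩, hκ0, fun h => ?_, hbound, fun s t => ?_⟩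
  · rw [hasDerivAt_iff_isLittleO_nhds_zero]
    have h1 : (fun t : ℝ => t ^ 2) =o[𝓝 0] fun t : ℝ => t := by
      simpa using isLittleO_pow_id (𝕜 := ℝ) one_lt_two
    refine (hO.trans_isLittleO h1).congr_left fun t => ?_
    rw [zero_add, h0, smul_eq_mul]
    ring
  · rw [hκ, hr, hq0 h]
    simp
  · set U := NormedSpace.exp ((Complex.I * (s : ℂ)) • (X + (t : ℂ) • D)) with hU
    set z := Complex.exp (Complex.I * (s * (E + g * t) : ℝ)) with hz
    -- Passing from `p` to `p + tq` before and after the evolution costs `|t| ‖q‖` each time, hence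
    -- the `2‖q‖` in `κ`.
    have h1 : U *ᵥ p - z • p = (U *ᵥ (p + (t : ℂ) • q) - z • (p + (t : ℂ) • q)) -
        (t : ℂ) • (U *ᵥ q) + (t : ℂ) • (z • q) := by
      rw [Matrix.mulVec_add, Matrix.mulVec_smul, smul_add, smul_comm z]
      abel
    have hz1 : ‖z‖ = 1 := by rw [hz, mul_comm, Complex.norm_exp_ofReal_mul_I]
    have h2 := norm_exp_mulVec_sub_le (isHermitian_add_smul hX hD t) s (E + g * t)
      (p + (t : ℂ) • q)
    rw [hres, WithLp.toLp_smul, norm_smul, Complex.norm_real, Real.norm_eq_abs,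
      abs_of_nonneg (sq_nonneg t)] at h2
    have h3 := norm_exp_mulVec (isHermitian_add_smul hX hD t) s q
    rw [h1, WithLp.toLp_add, WithLp.toLp_sub, WithLp.toLp_smul, WithLp.toLp_smul]
    refine (norm_add_le _ _).trans ((add_le_add_left (norm_sub_le _ _) _).trans ?_)
    rw [norm_smul, norm_smul, WithLp.toLp_smul, norm_smul, hz1, Complex.norm_real,
      Real.norm_eq_abs, one_mul]
    calc _ ≤ |s| * (t ^ 2 * ‖WithLp.toLp 2 r‖) + |t| * ‖WithLp.toLp 2 q‖ +
          |t| * ‖WithLp.toLp 2 q‖ := by gcongr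
      _ = |t| * (2 * ‖WithLp.toLp 2 q‖) + |s| * t ^ 2 * ‖WithLp.toLp 2 r‖ := by ring
      _ ≤ |t| * κ + |s| * t ^ 2 * κ := by gcongr
      _ = κ * (|t| + |s| * t ^ 2) := by ring

/-! ### Phases and geometric sums -/

theorem phase_eq_exp_I_mul (x : ℝ) : phase x = Complex.exp (Complex.I * (2 * Real.pi * x : ℝ)) := by
  rw [phase]
  push_cast
  ring_nf

theorem phase_add (x y : ℝ) : phase (x + y) = phase x * phase y := by
  rw [phase, phase, phase, ← Complex.exp_add]
  push_cast
  ring_nf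

theorem phase_zero : phase 0 = 1 := by simp [phase]

theorem phase_nat_mul (e : ℕ) (x : ℝ) : phase (e * x) = phase x ^ e := by
  rw [phase, phase, ← Complex.exp_nat_mul]
  push_cast
  ring_nf

theorem phase_eq_one_iff (x : ℝ) : phase x = 1 ↔ ∃ z : ℤ, x = z := by
  rw [phase, Complex.exp_eq_one_iff]
  refine exists_congr fun z => ?_
  rw [mul_comm, mul_left_inj' Complex.two_pi_I_ne_zero]
  norm_cast

theorem phase_intCast (z : ℤ) : phase z = 1 := (phase_eq_one_iff _).2 ⟨z, rfl⟩

theorem norm_phase (x : ℝ) : ‖phase x‖ = 1 := by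
  rw [phase_eq_exp_I_mul, mul_comm, Complex.norm_exp_ofReal_mul_I]

theorem norm_phase_sub_phase_le (x y : ℝ) : ‖phase x - phase y‖ ≤ 2 * Real.pi * |x - y| := by
  rw [phase_eq_exp_I_mul, phase_eq_exp_I_mul]
  refine (norm_exp_I_mul_sub_exp_I_mul_le _ _).trans ?_
  rw [← mul_sub, abs_mul, abs_of_pos Real.two_pi_pos]

theorem norm_phase_sub_one (x : ℝ) : ‖phase x - 1‖ = 2 * |Real.sin (Real.pi * x)| := by
  rw [phase_eq_exp_I_mul, Complex.norm_exp_I_mul_ofReal_sub_one, norm_mul, Real.norm_eq_abs,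
    Real.norm_eq_abs, abs_two]
  ring_nf

theorem geom_sum_phase_mul (M : ℕ) (x : ℝ) :
    (∑ e ∈ Finset.range M, phase (e * x)) * (phase x - 1) = phase (M * x) - 1 := by
  simp_rw [phase_nat_mul]
  exact geom_sum_mul _ _

/-- Take norms in the geometric sum identity and bound a chord by its arc. The product form avoids
dividing by `x`. -/
theorem abs_sin_le_norm_geom_sum_phase (M : ℕ) (x : ℝ) :
    |Real.sin (Real.pi * (M * x))| ≤
      ‖∑ e ∈ Finset.range M, phase (e * x)‖ * (Real.pi * |x|) := by
  have h1 := congrArg norm (geom_sum_phase_mul M x)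
  rw [norm_mul, norm_phase_sub_one (M * x)] at h1
  have h2 := norm_phase_sub_phase_le x 0
  rw [phase_zero, sub_zero] at h2
  have h3 := mul_le_mul_of_nonneg_left h2
    (norm_nonneg (∑ e ∈ Finset.range M, phase (e * x)))
  linarith

/-! ### Bit strings as integers -/

/-- Bit strings of length `m` enumerate the integers below `2 ^ m`. -/
def bitsEquiv (m : ℕ) : Bits m ≃ Fin (2 ^ m) :=
  ((Equiv.refl (Fin m)).arrowCongr finTwoEquiv.symm).trans finFunctionFinEquiv

theorem val_bitsEquiv {m : ℕ} (a : Bits m) : (bitsEquiv m a : ℕ) = bitValue a := by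
  rw [bitsEquiv, Equiv.trans_apply, finFunctionFinEquiv_apply, bitValue]
  refine Finset.sum_congr rfl fun j _ => ?_
  cases h : a j <;> simp [finTwoEquiv, h]

theorem bitValue_lt {m : ℕ} (a : Bits m) : bitValue a < 2 ^ m := by
  rw [← val_bitsEquiv]
  exact (bitsEquiv m a).isLt

theorem bitValue_injective (m : ℕ) : Function.Injective (bitValue : Bits m → ℕ) := by
  intro a b h
  rw [← val_bitsEquiv, ← val_bitsEquiv] at h
  exact (bitsEquiv m).injective (Fin.ext h)

theorem sum_bitValue {R : Type*} [AddCommMonoid R] (m : ℕ) (F : ℕ → R) :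
    ∑ a : Bits m, F (bitValue a) = ∑ e ∈ Finset.range (2 ^ m), F e := by
  rw [Finset.sum_range, ← (bitsEquiv m).sum_comp]
  simp [val_bitsEquiv]

theorem exists_bitValue_eq_intCast_sub (m : ℕ) (k : ℤ) :
    ∃ (b : Bits m) (z : ℤ), (k : ℝ) = bitValue b + 2 ^ m * z := by
  have hM : (0 : ℤ) < 2 ^ m := by positivity
  have h0 := Int.emod_nonneg k hM.ne'
  have h1 := Int.emod_lt_of_pos k hM
  have h2 : (k % 2 ^ m).toNat < 2 ^ m := by
    zify
    rwa [Int.toNat_of_nonneg h0]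
  refine ⟨(bitsEquiv m).symm ⟨_, h2⟩, k / 2 ^ m, ?_⟩
  rw [← val_bitsEquiv, Equiv.apply_symm_apply]
  have h3 : (((k % 2 ^ m).toNat : ℤ) : ℝ) = ((k % 2 ^ m : ℤ) : ℝ) := by
    rw [Int.toNat_of_nonneg h0]
  rw [Int.cast_natCast] at h3
  rw [h3]
  exact_mod_cast (Int.emod_add_mul_ediv k (2 ^ m)).symm

/-! ### The Fourier peak -/

section FourierPeak

variable {m : ℕ}

/-- The Fourier peak depends only on the distance of `2 ^ m * x` to `bitValue b`, modulo `2 ^ m`. -/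
theorem fourierPeak_eq_geom_sum {x y : ℝ} {b : Bits m} {z : ℤ}
    (h : 2 ^ m * x - y = bitValue b + 2 ^ m * z) :
    fourierPeak m x b =
      (∑ e ∈ Finset.range (2 ^ m), phase (e * (y / 2 ^ m))) / 2 ^ m := by
  rw [fourierPeak, ← sum_bitValue]
  congr 1
  refine Finset.sum_congr rfl fun a _ => ?_
  have h1 : -(bitValue a * (bitValue b - 2 ^ m * x) / 2 ^ m : ℝ) =
      bitValue a * (y / 2 ^ m) + ((bitValue a * z : ℤ) : ℝ) := by
    have h2 : (bitValue b : ℝ) = 2 ^ m * x - y - 2 ^ m * z := by linarith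
    rw [h2]
    push_cast
    field_simp
    ring
  rw [h1, phase_add, phase_intCast, mul_one]

theorem fourierPeak_eq_one {x : ℝ} {b : Bits m} {z : ℤ}
    (h : 2 ^ m * x = bitValue b + 2 ^ m * z) : fourierPeak m x b = 1 := by
  rw [fourierPeak_eq_geom_sum (y := 0) (z := z) (by rw [sub_zero, h])]
  simp [phase_zero]

/-- At any other outcome the geometric sum runs over all powers of a nontrivial `2 ^ m`-th root of
unity, hence vanishes. -/
theorem fourierPeak_eq_ket {x : ℝ} {b : Bits m} {z : ℤ}
    (h : 2 ^ m * x = bitValue b + 2 ^ m * z) : fourierPeak m x = ket b := by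
  ext b'
  rcases eq_or_ne b' b with rfl | hb
  · rw [fourierPeak_eq_one h, ket, Pi.single_eq_same]
  · rw [ket, Pi.single_eq_of_ne hb]
    set y : ℝ := (bitValue b : ℝ) - bitValue b' with hy
    have hM : (2 : ℝ) ^ m ≠ 0 := by positivity
    rw [fourierPeak_eq_geom_sum (y := y) (z := z) (by rw [h, hy]; ring)]
    have h1 := geom_sum_phase_mul (2 ^ m) (y / 2 ^ m)
    have h2 : phase (((2 ^ m : ℕ) : ℝ) * (y / 2 ^ m)) = 1 := by
      rw [phase_eq_one_iff]
      refine ⟨(bitValue b : ℤ) - bitValue b', ?_⟩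
      push_cast
      rw [mul_div_cancel₀ _ hM]
    rw [h2, sub_self, mul_eq_zero] at h1
    rcases h1 with h1 | h1
    · rw [h1, zero_div]
    -- Ratio `1` would make two integers in `[0, 2 ^ m)` congruent modulo `2 ^ m`.
    · exfalso
      rw [sub_eq_zero, phase_eq_one_iff] at h1
      obtain ⟨w, hw⟩ := h1
      rw [div_eq_iff hM, hy] at hw
      have hw' : (bitValue b : ℤ) - bitValue b' = w * 2 ^ m := by exact_mod_cast hw
      have hlt : (bitValue b : ℤ) < 2 ^ m := by exact_mod_cast bitValue_lt b
      have hlt' : (bitValue b' : ℤ) < 2 ^ m := by exact_mod_cast bitValue_lt b'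
      have hz : (bitValue b : ℤ) - bitValue b' = 0 := by
        refine Int.eq_zero_of_abs_lt_dvd (m := 2 ^ m) ⟨w, by rw [hw', mul_comm]⟩ ?_
        rw [abs_lt]
        constructor <;> omega
      exact hb (bitValue_injective m (by omega))

theorem abs_sin_le_norm_fourierPeak {x y : ℝ} {b : Bits m} {z : ℤ}
    (h : 2 ^ m * x - y = bitValue b + 2 ^ m * z) :
    |Real.sin (Real.pi * y)| ≤ ‖fourierPeak m x b‖ * (Real.pi * |y|) := by
  have hM : (0 : ℝ) < 2 ^ m := by positivity
  have h1 := abs_sin_le_norm_geom_sum_phase (2 ^ m) (y / 2 ^ m)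
  rw [fourierPeak_eq_geom_sum h, norm_div, norm_pow, Complex.norm_ofNat]
  rw [abs_div, abs_of_pos hM] at h1
  push_cast at h1
  rw [mul_div_cancel₀ _ hM.ne'] at h1
  exact h1.trans (le_of_eq (by ring))

theorem invQFT_mulVec_phaseState (x : ℝ) :
    invQFT m *ᵥ phaseState m (fun e => e * x) = fourierPeak m x := by
  ext b
  simp only [Matrix.mulVec, dotProduct, invQFT, Matrix.of_apply, phaseState, fourierPeak]
  rw [Finset.sum_div]
  refine Finset.sum_congr rfl fun a _ => ?_
  rw [div_mul_div_comm, ← phase_add, ← Complex.ofReal_mul,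
    Real.mul_self_sqrt (by positivity)]
  have hM : (2 : ℝ) ^ m ≠ 0 := by positivity
  congr 2
  · field_simp
    ring
  · push_cast
    rfl

/-! ### The probability of the two central outcomes -/

/-- Equality holds at `d = 1/2`, so a sharp estimate is needed there. For `d ≤ 0.24` the cubic bound
on `sin` gives `sin (πd) ≥ 2.84 d`, and `2.84² > 8`. Otherwise, in terms of `v = (1 - 2d)²`, the
quadratic bound on `cos` gives `sin (πd) ≥ 1 - 1.234 v`, as `π²/8 < 1.234`, and a polynomial
inequality in `v` remains. -/
theorem eight_le_of_le_half {d : ℝ} (h0 : 0 < d) (h1 : d ≤ 1 / 2) :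
    8 * (d ^ 2 * (1 - d) ^ 2) ≤ Real.sin (Real.pi * d) ^ 2 * (d ^ 2 + (1 - d) ^ 2) := by
  have hpi1 := Real.pi_gt_d2
  have hpi2 := Real.pi_lt_d4
  rcases le_total d 0.24 with hd | hd
  · have h2 := Real.sin_ge_sub_cube (x := Real.pi * d) (by positivity)
    have h3 : (Real.pi * d) ^ 2 ≤ 0.57 := by
      have : Real.pi * d ≤ 3.1416 * 0.24 := by gcongr
      calc (Real.pi * d) ^ 2 ≤ (3.1416 * 0.24) ^ 2 := by gcongr
        _ ≤ 0.57 := by norm_num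
    have h4 : 2.84 * d ≤ Real.sin (Real.pi * d) := by
      have h5 : 2.84 * d ≤ Real.pi * d * (1 - (Real.pi * d) ^ 2 / 6) := by
        have h6 : (2.84 : ℝ) ≤ 3.14 * (1 - 0.57 / 6) := by norm_num
        calc 2.84 * d ≤ 3.14 * (1 - 0.57 / 6) * d := by gcongr
          _ = 3.14 * d * (1 - 0.57 / 6) := by ring
          _ ≤ Real.pi * d * (1 - (Real.pi * d) ^ 2 / 6) := by gcongr
      nlinarith
    calc 8 * (d ^ 2 * (1 - d) ^ 2) ≤ (2.84 * d) ^ 2 * (1 - d) ^ 2 := by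
          nlinarith [mul_nonneg (sq_nonneg d) (sq_nonneg (1 - d))]
      _ ≤ Real.sin (Real.pi * d) ^ 2 * (1 - d) ^ 2 := by gcongr
      _ ≤ Real.sin (Real.pi * d) ^ 2 * (d ^ 2 + (1 - d) ^ 2) := by
          gcongr
          nlinarith [sq_nonneg d]
  · set v : ℝ := (1 - 2 * d) ^ 2 with hv
    have hv0 : 0 ≤ v := sq_nonneg _
    have hv1 : v ≤ 0.2704 := by
      calc v ≤ (1 - 2 * 0.24) ^ 2 := by
            rw [hv]
            gcongr
            linarith
        _ = 0.2704 := by norm_num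
    have hc : 1 - 1.234 * v ≤ Real.sin (Real.pi * d) := by
      have h2 : Real.sin (Real.pi * d) = Real.cos (Real.pi * (1 - 2 * d) / 2) := by
        rw [← Real.cos_pi_div_two_sub]
        ring_nf
      have h3 := Real.one_sub_sq_div_two_le_cos (x := Real.pi * (1 - 2 * d) / 2)
      have h4 : Real.pi ^ 2 ≤ 9.8697 := by nlinarith
      have h5 := mul_le_mul_of_nonneg_right h4 hv0
      rw [h2]
      have h6 : (Real.pi * (1 - 2 * d) / 2) ^ 2 / 2 = Real.pi ^ 2 * v / 8 := by
        rw [hv]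
        ring
      rw [h6] at h3
      linarith
    have hs : (1 - 1.234 * v) ^ 2 ≤ Real.sin (Real.pi * d) ^ 2 := by
      gcongr
      linarith
    have h7 : (1 - v) ^ 2 ≤ (1 - 1.234 * v) ^ 2 * (1 + v) := by
      have h8 : 0 ≤ v * (0.532 - 1.945244 * v + 1.522756 * v ^ 2) := by
        apply mul_nonneg hv0
        nlinarith
      linarith
    have h9 : 8 * (d ^ 2 * (1 - d) ^ 2) = (1 - v) ^ 2 / 2 := by
      rw [hv]
      ring
    have h10 : d ^ 2 + (1 - d) ^ 2 = (1 + v) / 2 := by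
      rw [hv]
      ring
    rw [h9, h10]
    have h11 := mul_le_mul_of_nonneg_right hs (by linarith : (0 : ℝ) ≤ 1 + v)
    linarith

theorem eight_mul_le_sin_sq_mul {d : ℝ} (h0 : 0 < d) (h1 : d < 1) :
    8 * (d ^ 2 * (1 - d) ^ 2) ≤ Real.sin (Real.pi * d) ^ 2 * (d ^ 2 + (1 - d) ^ 2) := by
  rcases le_total d (1 / 2) with h | h
  · exact eight_le_of_le_half h0 h
  · have h2 := eight_le_of_le_half (d := 1 - d) (by linarith) (by linarith)
    have h3 : Real.sin (Real.pi * (1 - d)) = Real.sin (Real.pi * d) := by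
      rw [← Real.sin_pi_sub]
      ring_nf
    rw [h3, sub_sub_cancel] at h2
    linarith

open Classical in
/-- The two outcomes closest to `2 ^ m * x` carry at least `8 / π ^ 2` of the Fourier peak. -/
theorem eight_div_pi_sq_le_sum_fourierPeak {ε : ℝ} (hm : 1 ≤ m) (hε : 1 / 2 ^ m ≤ ε) (x : ℝ) :
    8 / Real.pi ^ 2 ≤ ∑ b : Bits m,
      if ∃ z : ℤ, |(bitValue b : ℝ) / 2 ^ m - x - z| ≤ ε then ‖fourierPeak m x b‖ ^ 2 else 0 := by
  have hM : (0 : ℝ) < 2 ^ m := by positivity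
  set P : Bits m → Prop := fun b => ∃ z : ℤ, |(bitValue b : ℝ) / 2 ^ m - x - z| ≤ ε with hP
  have hPy : ∀ {y : ℝ} {b : Bits m} {z : ℤ}, 2 ^ m * x - y = bitValue b + 2 ^ m * z →
      |y| ≤ 1 → P b := fun {y b z} h hy => by
    refine ⟨-z, le_trans ?_ hε⟩
    have h1 : (bitValue b : ℝ) / 2 ^ m - x - ((-z : ℤ) : ℝ) = -y / 2 ^ m := by
      have h2 : (bitValue b : ℝ) = 2 ^ m * x - y - 2 ^ m * z := by linarith
      rw [h2]
      push_cast
      field_simp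
      ring
    rw [h1, abs_div, abs_neg, abs_of_pos hM]
    gcongr
  have hnn : ∀ b, 0 ≤ if P b then ‖fourierPeak m x b‖ ^ 2 else 0 := fun b => by
    split_ifs <;> positivity
  obtain ⟨b₀, z₀, h₀⟩ := exists_bitValue_eq_intCast_sub m ⌊2 ^ m * x⌋
  obtain ⟨b₁, z₁, h₁⟩ := exists_bitValue_eq_intCast_sub m (⌊2 ^ m * x⌋ + 1)
  set d : ℝ := Int.fract (2 ^ m * x) with hd
  have hfl : (⌊2 ^ m * x⌋ : ℝ) = 2 ^ m * x - d := by
    rw [hd, Int.fract]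
    ring
  have hd0 : 0 ≤ d := Int.fract_nonneg _
  have hd1 : d < 1 := Int.fract_lt_one _
  have h₀' : 2 ^ m * x - d = bitValue b₀ + 2 ^ m * z₀ := by rw [← h₀, hfl]
  have h₁' : 2 ^ m * x - (d - 1) = bitValue b₁ + 2 ^ m * z₁ := by
    rw [← h₁]
    push_cast
    rw [hfl]
    ring
  have hP₀ : P b₀ := hPy h₀' (by rw [abs_of_nonneg hd0]; exact hd1.le)
  have hP₁ : P b₁ := hPy h₁' (by rw [abs_le]; constructor <;> linarith)
  rcases hd0.eq_or_lt with hz | hd0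
  -- When `2 ^ m * x` is an integer, one outcome has probability `1`; the two-outcome bound would
  -- degenerate.
  · rw [← hz, sub_zero] at h₀'
    refine le_trans ?_ (Finset.single_le_sum (fun b _ => hnn b) (Finset.mem_univ b₀))
    rw [if_pos hP₀, fourierPeak_eq_one h₀', norm_one, one_pow, div_le_one (by positivity)]
    nlinarith [Real.pi_gt_three]
  -- Consecutive integers differ modulo `2 ^ m` because `m ≥ 1`; for `m = 0` the outcomes would
  -- coincide.
  · have hne : b₀ ≠ b₁ := by
      rintro rfl
      have h2 : (2 : ℝ) ^ m * (z₁ - z₀) = 1 := by linarith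
      have h3 : (2 : ℤ) ^ m * (z₁ - z₀) = 1 := by exact_mod_cast h2
      have h4 : (2 : ℤ) ∣ 1 := h3 ▸ (dvd_pow_self 2 (by omega)).mul_right _
      omega
    have hsum := Finset.sum_le_sum_of_subset_of_nonneg (Finset.subset_univ {b₀, b₁})
      fun b _ _ => hnn b
    rw [Finset.sum_pair hne, if_pos hP₀, if_pos hP₁] at hsum
    refine le_trans ?_ hsum
    have hs₀ := abs_sin_le_norm_fourierPeak h₀'
    have hs₁ := abs_sin_le_norm_fourierPeak h₁'
    have h5 : Real.sin (Real.pi * (d - 1)) = -Real.sin (Real.pi * d) := by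
      rw [mul_sub, mul_one, Real.sin_sub_pi]
    rw [h5, abs_neg, abs_of_neg (by linarith : d - 1 < 0)] at hs₁
    rw [abs_of_pos hd0] at hs₀
    have hd1' : 0 < 1 - d := by linarith
    have hq₀ := pow_le_pow_left₀ (abs_nonneg _) hs₀ 2
    have hq₁ := pow_le_pow_left₀ (abs_nonneg _) hs₁ 2
    rw [sq_abs, mul_pow, mul_pow] at hq₀ hq₁
    have h8 := eight_mul_le_sin_sq_mul hd0 hd1
    rw [div_le_iff₀ (by positivity)]
    have hdd : 0 < d ^ 2 * (1 - d) ^ 2 := by positivity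
    -- Clearing the denominators `d²` and `(1 - d)²` of the two amplitude bounds reduces the claim
    -- to the trigonometric inequality.
    refine le_of_mul_le_mul_right (h8.trans ?_) hdd
    have hr₀ := mul_le_mul_of_nonneg_right hq₀ (sq_nonneg (1 - d))
    have hr₁ := mul_le_mul_of_nonneg_right hq₁ (sq_nonneg d)
    rw [neg_sub] at hr₁
    linarith

end FourierPeak

/-! ### Norms and probabilities of joint states -/

section JointStates

variable {m n : ℕ}

theorem l2norm_sub_le (u v w : JointState m n) :
    l2norm (u - w) ≤ l2norm (u - v) + l2norm (v - w) := by
  rw [l2norm, ← sub_add_sub_cancel u v w, WithLp.toLp_add]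
  exact norm_add_le _ _

theorem l2norm_sq (v : JointState m n) :
    l2norm v ^ 2 = ∑ a, ‖WithLp.toLp 2 fun y => v (a, y)‖ ^ 2 := by
  simp_rw [l2norm, EuclideanSpace.norm_sq_eq, Fintype.sum_prod_type]

/-- The `ℓ²` norm of the block norms is at most their `ℓ¹` norm; crude, but the constants may depend
on `m`. -/
theorem l2norm_le_sum (v : JointState m n) {f : Bits m → ℝ}
    (h : ∀ a, ‖WithLp.toLp 2 fun y => v (a, y)‖ ≤ f a) : l2norm v ≤ ∑ a, f a := by
  have hf : ∀ a, 0 ≤ f a := fun a => (norm_nonneg _).trans (h a)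
  refine le_of_sq_le_sq ?_ (Finset.sum_nonneg fun a _ => hf a)
  rw [l2norm_sq]
  refine (Finset.sum_le_sum fun a _ => pow_le_pow_left₀ (norm_nonneg _) (h a) 2).trans ?_
  exact Finset.sum_sq_le_sq_sum_of_nonneg fun a _ => hf a

theorem norm_apply_le_l2norm (v : JointState m n) (s : Bits m × Bits n) : ‖v s‖ ≤ l2norm v :=
  PiLp.norm_apply_le (WithLp.toLp 2 v) s

theorem readout_sub (v w : JointState m n) : readout (v - w) = readout v - readout w :=
  Matrix.mulVec_sub _ _ _

theorem readout_smul (c : ℂ) (v : JointState m n) : readout (c • v) = c • readout v :=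
  Matrix.mulVec_smul _ _ _

theorem readout_tensor_phaseState (x : ℝ) (ψ : Bits n → ℂ) :
    readout (tensor (phaseState m fun e => e * x) ψ) = tensor (fourierPeak m x) ψ := by
  rw [readout, kronecker_one_mulVec_tensor, invQFT_mulVec_phaseState]

/-- Any operator norm bound suffices, being absorbed into `C`; unitarity of the Fourier transform is
not needed. -/
theorem exists_l2norm_readout_le (m n : ℕ) :
    ∃ R : ℝ, 0 ≤ R ∧ ∀ v : JointState m n, l2norm (readout v) ≤ R * l2norm v :=
  ⟨_, norm_nonneg _, fun v => (LinearMap.toContinuousLinearMap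
    (Matrix.toLpLin 2 2 (invQFT m ⊗ₖ (1 : Op n)))).le_opNorm (WithLp.toLp 2 v)⟩

/-- Outcome probabilities are stable under perturbations of the state. -/
theorem probWithin_sub_le (v w : JointState m n) (x r : ℝ) :
    probWithin w x r - 2 * (∑ s, ‖w s‖) * l2norm (v - w) ≤ probWithin v x r := by
  have h : ∀ s, ‖w s‖ ^ 2 - 2 * ‖w s‖ * l2norm (v - w) ≤ ‖v s‖ ^ 2 := fun s => by
    have h1 : ‖w s‖ - ‖v s‖ ≤ l2norm (v - w) := by
      refine (norm_sub_norm_le _ _).trans ?_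
      rw [norm_sub_rev]
      exact norm_apply_le_l2norm (v - w) s
    -- `‖v‖² = ‖w‖² - 2‖w‖(‖w‖ - ‖v‖) + (‖w‖ - ‖v‖)²`, with the last square dropped.
    nlinarith [norm_nonneg (w s), sq_nonneg (‖w s‖ - ‖v s‖)]
  have h0 : 0 ≤ l2norm (v - w) := norm_nonneg _
  rw [Fintype.sum_prod_type, Finset.mul_sum, Finset.sum_mul, probWithin, probWithin,
    ← Finset.sum_sub_distrib]
  refine Finset.sum_le_sum fun b _ => ?_
  split_ifs
  · rw [Finset.mul_sum, Finset.sum_mul, ← Finset.sum_sub_distrib]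
    exact Finset.sum_le_sum fun y _ => h (b, y)
  · rw [zero_sub, neg_nonpos]
    positivity

open Classical in
theorem probWithin_smul_tensor {c : ℂ} (hc : ‖c‖ = 1) (u : Bits m → ℂ) {p : Bits n → ℂ}
    (hp : star p ⬝ᵥ p = 1) (x r : ℝ) :
    probWithin (c • tensor u p) x r = ∑ b : Bits m,
      if ∃ z : ℤ, |(bitValue b : ℝ) / 2 ^ m - x - z| ≤ r then ‖u b‖ ^ 2 else 0 := by
  rw [probWithin]
  refine Finset.sum_congr rfl fun b _ => ?_
  have h : ∑ y, ‖p y‖ ^ 2 = 1 := by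
    have := EuclideanSpace.norm_sq_eq (WithLp.toLp 2 p)
    rw [norm_toLp_eq_one hp, one_pow] at this
    exact this.symm
  congr 1
  simp only [Pi.smul_apply, tensor, smul_eq_mul, norm_mul, hc, one_mul, mul_pow]
  rw [← Finset.mul_sum, h, mul_one]

end JointStates

/-! ### The state prepared by gradient phase estimation -/

section Estimates

variable {m n : ℕ}

theorem evolution_eq_exp (X D : Op n) (N : ℕ) (W L : ℝ) (e : ℕ) :
    evolution X D N W L e =
      NormedSpace.exp ((Complex.I * ((2 * Real.pi * (N / (W * L)) : ℝ) : ℂ)) •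
        (X + ((L * e / N : ℝ) : ℂ) • D)) := by
  rw [evolution]
  congr 2
  push_cast
  ring

theorem norm_one_div_sqrt_two_pow_le (m : ℕ) : ‖(1 / ((Real.sqrt (2 ^ m) : ℝ) : ℂ))‖ ≤ 1 := by
  rw [norm_div, norm_one, Complex.norm_real, Real.norm_eq_abs, abs_of_nonneg (Real.sqrt_nonneg _)]
  have h : 1 ≤ Real.sqrt (2 ^ m) := Real.one_le_sqrt.2 (one_le_pow₀ one_le_two)
  exact (div_le_one (by linarith)).2 h

/-- The accumulated deviation, per unit of `L`, of the controlled evolutions from pure phases. -/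
noncomputable def deviation (m N : ℕ) (W : ℝ) : ℝ :=
  ∑ a : Bits m, ((bitValue a : ℝ) / N + 2 * Real.pi * (bitValue a : ℝ) ^ 2 / (W * N))

theorem deviation_nonneg (m N : ℕ) {W : ℝ} (hW : 0 < W) : 0 ≤ deviation m N W :=
  Finset.sum_nonneg fun a _ => by positivity

/-- The evolution time grows like `1/L` while the squared perturbation shrinks like `L²`, leaving an
error linear in `L`. -/
theorem abs_add_abs_mul_sq_eq {N : ℕ} {W L : ℝ} (hN : 0 < N) (hW : 0 < W) (hL : 0 < L) (e : ℕ) :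
    |L * e / N| + |2 * Real.pi * (N / (W * L))| * (L * e / N) ^ 2 =
      ((e : ℝ) / N + 2 * Real.pi * (e : ℝ) ^ 2 / (W * N)) * L := by
  have hN' : (0 : ℝ) < N := by exact_mod_cast hN
  have hpi := Real.pi_pos
  rw [abs_of_nonneg (by positivity), abs_of_nonneg (by positivity)]
  field_simp

variable {X D : Op n} {E g κ : ℝ} {p : Bits n → ℂ}

theorem l2norm_qgpe_sub_le (hX : X.IsHermitian) (hD : D.IsHermitian)
    (h : ∀ s t : ℝ, ‖WithLp.toLp 2
        (NormedSpace.exp ((Complex.I * (s : ℂ)) • (X + (t : ℂ) • D)) *ᵥ p -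
          Complex.exp (Complex.I * (s * (E + g * t) : ℝ)) • p)‖ ≤ κ * (|t| + |s| * t ^ 2))
    {N : ℕ} {W L : ℝ} (hN : 0 < N) (hW : 0 < W) (hL : 0 < L) :
    l2norm (Circuit.toOp (qgpe m hX hD N W L) *ᵥ tensor (ketZero m) p -
      phase (N / (W * L) * E) • tensor (phaseState m fun e => e * (g / W)) p) ≤
      κ * deviation m N W * L := by
  have hN' : (N : ℝ) ≠ 0 := by exact_mod_cast hN.ne'
  rw [qgpe_mulVec hX hD hN hW hL, deviation, mul_assoc, Finset.sum_mul, Finset.mul_sum]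
  refine l2norm_le_sum _ fun a => ?_
  rw [← abs_add_abs_mul_sq_eq hN hW hL]
  set s : ℝ := 2 * Real.pi * (N / (W * L)) with hs
  set t : ℝ := L * bitValue a / N with ht
  -- The long time `s` and the small step `t` combine so that `s g t` is the `L`-independent phase
  -- `2π a g / W`.
  have hph : phase (N / (W * L) * E) * phase (bitValue a * (g / W)) =
      Complex.exp (Complex.I * (s * (E + g * t) : ℝ)) := by
    rw [← phase_add, phase_eq_exp_I_mul]
    congr 3
    rw [hs, ht]
    field_simp
  have heq : (fun y => ((fun s : Bits m × Bits n => (1 / ((Real.sqrt (2 ^ m) : ℝ) : ℂ)) *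
        (evolution X D N W L (bitValue s.1) *ᵥ p) s.2) -
      phase (N / (W * L) * E) • tensor (phaseState m fun e => e * (g / W)) p) (a, y)) =
      (1 / ((Real.sqrt (2 ^ m) : ℝ) : ℂ)) • (evolution X D N W L (bitValue a) *ᵥ p -
        Complex.exp (Complex.I * (s * (E + g * t) : ℝ)) • p) := by
    ext y
    simp only [Pi.sub_apply, Pi.smul_apply, tensor, phaseState, smul_eq_mul, ← hph]
    ring
  rw [heq, WithLp.toLp_smul, norm_smul, evolution_eq_exp]
  exact (mul_le_of_le_one_left (norm_nonneg _) (norm_one_div_sqrt_two_pow_le m)).trans (h s t)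

/-- Phases are Lipschitz and `lam` is linear up to `κ t²`. The spare `|t|` in `deviation` is kept so
that both estimates share a constant. -/
theorem l2norm_phaseState_sub_le {lam : ℝ → ℝ} (hp : star p ⬝ᵥ p = 1) (hκ : 0 ≤ κ)
    (h : ∀ t, |lam t - (E + g * t)| ≤ κ * t ^ 2)
    {N : ℕ} {W L : ℝ} (hN : 0 < N) (hW : 0 < W) (hL : 0 < L) :
    l2norm (phase (N / (W * L) * E) • tensor (phaseState m fun e => e * (g / W)) p -
      tensor (phaseState m fun e => N / (W * L) * lam (L * e / N)) p) ≤
      κ * deviation m N W * L := by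
  have hN' : (N : ℝ) ≠ 0 := by exact_mod_cast hN.ne'
  rw [deviation, mul_assoc, Finset.sum_mul, Finset.mul_sum]
  refine l2norm_le_sum _ fun a => ?_
  rw [← abs_add_abs_mul_sq_eq hN hW hL]
  set t : ℝ := L * bitValue a / N with ht
  have hph : phase (N / (W * L) * E) * phase (bitValue a * (g / W)) =
      phase (N / (W * L) * (E + g * t)) := by
    rw [← phase_add]
    congr 1
    rw [ht]
    field_simp
  have heq : (fun y =>
      (phase (N / (W * L) * E) • tensor (phaseState m fun e => e * (g / W)) p -
        tensor (phaseState m fun e => N / (W * L) * lam (L * e / N)) p) (a, y)) =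
      (1 / ((Real.sqrt (2 ^ m) : ℝ) : ℂ)) • ((phase (N / (W * L) * (E + g * t)) -
        phase (N / (W * L) * lam t)) • p) := by
    rw [← hph]
    ext y
    simp only [Pi.sub_apply, Pi.smul_apply, tensor, phaseState, smul_eq_mul, ← ht]
    ring
  rw [heq, WithLp.toLp_smul, norm_smul, WithLp.toLp_smul, norm_smul, norm_toLp_eq_one hp, mul_one]
  refine (mul_le_of_le_one_left (norm_nonneg _) (norm_one_div_sqrt_two_pow_le m)).trans ?_
  refine (norm_phase_sub_phase_le _ _).trans ?_
  rw [← mul_sub, abs_mul, abs_sub_comm, ← mul_assoc, abs_mul (2 * Real.pi),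
    abs_of_pos Real.two_pi_pos]
  calc 2 * Real.pi * |(N / (W * L) : ℝ)| * |lam t - (E + g * t)|
      ≤ 2 * Real.pi * |(N / (W * L) : ℝ)| * (κ * t ^ 2) := by
        gcongr
        exact h t
    _ = κ * (2 * Real.pi * |(N / (W * L) : ℝ)| * t ^ 2) := by ring
    _ ≤ κ * (|t| + 2 * Real.pi * |(N / (W * L) : ℝ)| * t ^ 2) := by
        gcongr
        exact le_add_of_nonneg_left (abs_nonneg t)

end Estimates

/-! ### Precision and the number of answer qubits -/

theorem one_le_and_one_div_two_pow_le {ε : ℝ} {m : ℕ} (h0 : 0 < ε) (h1 : ε < 1)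
    (hm : m = ⌈Real.logb 2 (1 / ε)⌉₊) : 1 ≤ m ∧ 1 / 2 ^ m ≤ ε := by
  have hlog : 0 < Real.logb 2 (1 / ε) :=
    Real.logb_pos one_lt_two (by rw [lt_div_iff₀ h0]; linarith)
  refine ⟨hm ▸ Nat.one_le_iff_ne_zero.2 (Nat.ceil_pos.2 hlog).ne', ?_⟩
  have h2 : Real.logb 2 (1 / ε) ≤ m := hm ▸ Nat.le_ceil _
  rw [Real.logb_le_iff_le_rpow one_lt_two (by positivity), Real.rpow_natCast] at h2
  rw [div_le_iff₀ (by positivity)]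
  rw [div_le_iff₀ h0] at h2
  linarith

theorem natCeil_logb_le {ε : ℝ} (h0 : 0 < ε) (h1 : ε ≤ 1 / 2) :
    ((⌈Real.logb 2 (1 / ε)⌉₊ : ℕ) : ℝ) ≤ 2 * Real.logb 2 (1 / ε) := by
  have h2 : 1 ≤ Real.logb 2 (1 / ε) := by
    rw [Real.le_logb_iff_rpow_le one_lt_two (by positivity), Real.rpow_one, le_div_iff₀ h0]
    linarith
  have h3 := Nat.ceil_lt_add_one (by linarith : 0 ≤ Real.logb 2 (1 / ε))
  linarith

end QGPE

/-! ### Assembly of the circuit identities and error estimates -/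

theorem mainTheorem4 :
    ∃ K : ℝ, ∀ (n : ℕ) (X D : QGPE.Op n) (hX : X.IsHermitian) (hD : D.IsHermitian),
      -- the circuit, exactly, and its cost
      (∀ (m N : ℕ) (W L : ℝ), 0 < N → 0 < W → 0 < L →
        (QGPE.qgpeGate m hX hD N W L).toOp =
          QGPE.controlled (fun a => QGPE.evolution X D N W L (QGPE.bitValue a)) ∧
        (∀ ψ : QGPE.Bits n → ℂ,
          (QGPE.Circuit.toOp (QGPE.hadamardLayer m n)) *ᵥ
              QGPE.tensor (QGPE.ketZero m) ψ =
            QGPE.tensor (fun _ => 1 / ((Real.sqrt (2 ^ m) : ℝ) : ℂ)) ψ ∧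
          (QGPE.Circuit.toOp (QGPE.qgpe m hX hD N W L)) *ᵥ
              QGPE.tensor (QGPE.ketZero m) ψ =
            fun s => (1 / ((Real.sqrt (2 ^ m) : ℝ) : ℂ)) *
              (QGPE.evolution X D N W L (QGPE.bitValue s.1) *ᵥ ψ) s.2) ∧
        (Commute X D →
          QGPE.Circuit.toOp (QGPE.qgpe m hX hD N W L) =
            QGPE.Circuit.toOp (QGPE.qpe m hD (1 / W)) *
              ((1 : QGPE.Op m) ⊗ₖ QGPE.evolution X D N W L 0)) ∧
        QGPE.Circuit.cost (QGPE.qgpe m hX hD N W L) =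
          QGPE.Circuit.cost (QGPE.qpe m hD (1 / W)) + 1 ∧
        (1 ≤ m → (QGPE.Circuit.cost (QGPE.qgpe m hX hD N W L) : ℝ) ≤ K * m)) ∧
      -- standard phase estimation, for comparison
      (∀ (m : ℕ) (r x : ℝ) (ψ : QGPE.Bits n → ℂ), ((r : ℂ) • D) *ᵥ ψ = (x : ℂ) • ψ →
        (QGPE.Circuit.toOp (QGPE.qpe m hD r)) *ᵥ QGPE.tensor (QGPE.ketZero m) ψ =
          QGPE.tensor (QGPE.phaseState m fun e => e * x) ψ) ∧
      -- the action on an eigenvector of `X`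
      (∀ (E : ℝ) (p : QGPE.Bits n → ℂ), X *ᵥ p = (E : ℂ) • p → star p ⬝ᵥ p = 1 →
        (∀ q : QGPE.Bits n → ℂ, X *ᵥ q = (E : ℂ) • q → star q ⬝ᵥ p = 0 →
          star q ⬝ᵥ (D *ᵥ p) = 0) →
        ∃ (lam : ℝ → ℝ) (g : ℝ), QGPE.IsEigenvalueBranch X D E lam g ∧
          (∀ (N : ℕ) (W : ℝ), 0 < N → 0 < W →
            -- the oracle of the gradient algorithm, its linearization, and the read-out
            (∀ m : ℕ, ∃ C : ℝ, (D *ᵥ p = (g : ℂ) • p → C = 0) ∧ ∀ L : ℝ, 0 < L →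
              QGPE.l2norm
                ((QGPE.Circuit.toOp (QGPE.qgpe m hX hD N W L)) *ᵥ
                    QGPE.tensor (QGPE.ketZero m) p -
                  QGPE.tensor
                    (QGPE.phaseState m fun e => N / (W * L) * lam (L * e / N)) p) ≤ C * L ∧
              QGPE.l2norm
                ((QGPE.Circuit.toOp (QGPE.qgpe m hX hD N W L)) *ᵥ
                    QGPE.tensor (QGPE.ketZero m) p -
                  QGPE.phase (N / (W * L) * E) •
                    QGPE.tensor (QGPE.phaseState m fun e => e * (g / W)) p) ≤ C * L ∧
              QGPE.l2norm
                (QGPE.readout ((QGPE.Circuit.toOp (QGPE.qgpe m hX hD N W L)) *ᵥ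
                    QGPE.tensor (QGPE.ketZero m) p) -
                  QGPE.phase (N / (W * L) * E) •
                    QGPE.tensor (QGPE.fourierPeak m (g / W)) p) ≤ C * L ∧
              (∀ (b : QGPE.Bits m) (z : ℤ),
                2 ^ m / W * g = (QGPE.bitValue b : ℝ) + 2 ^ m * z →
                QGPE.l2norm
                  (QGPE.readout ((QGPE.Circuit.toOp (QGPE.qgpe m hX hD N W L)) *ᵥ
                      QGPE.tensor (QGPE.ketZero m) p) -
                    QGPE.phase (N / (W * L) * E) •
                      QGPE.tensor (QGPE.ket b) p) ≤ C * L)) ∧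
            -- precision and the number of qubits
            (∀ (ε : ℝ) (m : ℕ), 0 < ε → ε < 1 → m = ⌈Real.logb 2 (1 / ε)⌉₊ →
              (∃ C : ℝ, (D *ᵥ p = (g : ℂ) • p → C = 0) ∧ ∀ L : ℝ, 0 < L →
                8 / Real.pi ^ 2 - C * L ≤
                  QGPE.probWithin
                    (QGPE.readout ((QGPE.Circuit.toOp (QGPE.qgpe m hX hD N W L)) *ᵥ
                      QGPE.tensor (QGPE.ketZero m) p)) (g / W) ε) ∧
              (ε ≤ 1 / 2 → ∀ L : ℝ, 0 < L →
                (QGPE.Circuit.cost (QGPE.qgpe m hX hD N W L) : ℝ) ≤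
                  K * Real.logb 2 (1 / ε))))) := by
  -- The cost `2m + 1` is at most `3m`, and `m ≤ 2 log₂ (1/ε)` for `ε ≤ 1/2`, so `6` serves both
  -- bounds.
  refine ⟨6, fun n X D hX hD => ⟨fun m N W L hN hW hL => ?_, ?_, ?_⟩⟩
  · refine ⟨QGPE.qgpeGate_toOp hX hD hN hW hL,
      fun ψ => ⟨QGPE.hadamardLayer_mulVec_ketZero ψ, QGPE.qgpe_mulVec hX hD hN hW hL ψ⟩,
      fun h => QGPE.qgpe_toOp_of_commute hX hD h hN hW hL, ?_, fun hm => ?_⟩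
    · rw [QGPE.cost_qgpe, QGPE.cost_qpe]
    · have hm' : (1 : ℝ) ≤ m := by exact_mod_cast hm
      rw [QGPE.cost_qgpe]
      push_cast
      linarith
  · exact fun m r x ψ h => QGPE.qpe_mulVec_of_eigenvector hD h
  · intro E p hp hp1 hdeg
    obtain ⟨lam, g, κ, hbranch, hκ, hκ0, hlam, hU⟩ :=
      QGPE.exists_eigenvalueBranch hX hD hp hp1 hdeg
    refine ⟨lam, g, hbranch, fun N W hN hW => ?_⟩
    have hstate := fun (m : ℕ) {L : ℝ} (hL : 0 < L) =>
      QGPE.l2norm_qgpe_sub_le (m := m) hX hD hU hN hW hL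
    have hread : ∀ m : ℕ, ∃ R : ℝ, 0 ≤ R ∧ ∀ L : ℝ, 0 < L →
        QGPE.l2norm
          (QGPE.readout ((QGPE.Circuit.toOp (QGPE.qgpe m hX hD N W L)) *ᵥ
              QGPE.tensor (QGPE.ketZero m) p) -
            QGPE.phase (N / (W * L) * E) •
              QGPE.tensor (QGPE.fourierPeak m (g / W)) p) ≤
          R * (κ * QGPE.deviation m N W * L) := fun m => by
      obtain ⟨R, hR, hRv⟩ := QGPE.exists_l2norm_readout_le m n
      refine ⟨R, hR, fun L hL => ?_⟩
      rw [← QGPE.readout_tensor_phaseState, ← QGPE.readout_smul, ← QGPE.readout_sub]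
      exact (hRv _).trans (mul_le_mul_of_nonneg_left (hstate m hL) hR)
    refine ⟨fun m => ?_, fun ε m hε0 hε1 hm => ⟨?_, fun hε2 L hL => ?_⟩⟩
    · obtain ⟨R, hR, hread⟩ := hread m
      have hdev := QGPE.deviation_nonneg m N hW
      have hle : ∀ L : ℝ, 0 < L → 0 ≤ κ * QGPE.deviation m N W * L ∧
          0 ≤ R * (κ * QGPE.deviation m N W * L) := fun L hL => by
        constructor <;> positivity
      -- The `2` pays for reaching the oracle state through the linear-phase state, `R` for the
      -- read-out; the factor `κ` makes the constant vanish in the exact case.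
      refine ⟨(2 + R) * (κ * QGPE.deviation m N W), fun h => by rw [hκ0 h]; ring,
        fun L hL => ?_⟩
      obtain ⟨hle1, hle2⟩ := hle L hL
      have hC : (2 + R) * (κ * QGPE.deviation m N W) * L =
          2 * (κ * QGPE.deviation m N W * L) + R * (κ * QGPE.deviation m N W * L) := by ring
      rw [hC]
      have h2 := hstate m hL
      have h3 := hread L hL
      refine ⟨?_, by linarith, by linarith, fun b z hb => ?_⟩
      · refine (QGPE.l2norm_sub_le _ _ _).trans
          ((add_le_add h2 (QGPE.l2norm_phaseState_sub_le hp1 hκ hlam hN hW hL)).trans ?_)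
        linarith
      · rw [QGPE.fourierPeak_eq_ket (b := b) (z := z) (by rw [← hb]; ring)] at h3
        linarith
    · obtain ⟨R, hR, hread⟩ := hread m
      obtain ⟨hm1, hmε⟩ := QGPE.one_le_and_one_div_two_pow_le hε0 hε1 hm
      set S : ℝ := ∑ s, ‖QGPE.tensor (QGPE.fourierPeak m (g / W)) p s‖ with hS
      have hS0 : 0 ≤ S := Finset.sum_nonneg fun _ _ => norm_nonneg _
      refine ⟨2 * S * (R * (κ * QGPE.deviation m N W)), fun h => by rw [hκ0 h]; ring,
        fun L hL => ?_⟩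
      have h1 := QGPE.probWithin_sub_le
        (QGPE.readout ((QGPE.Circuit.toOp (QGPE.qgpe m hX hD N W L)) *ᵥ
          QGPE.tensor (QGPE.ketZero m) p))
        (QGPE.phase (N / (W * L) * E) • QGPE.tensor (QGPE.fourierPeak m (g / W)) p) (g / W) ε
      rw [QGPE.probWithin_smul_tensor (QGPE.norm_phase _) _ hp1] at h1
      simp only [Pi.smul_apply, norm_smul, QGPE.norm_phase, one_mul, ← hS] at h1
      have h2 := QGPE.eight_div_pi_sq_le_sum_fourierPeak hm1 hmε (g / W)
      have h3 := mul_le_mul_of_nonneg_left (hread L hL) (by linarith : 0 ≤ 2 * S)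
      linarith
    · obtain ⟨hm1, -⟩ := QGPE.one_le_and_one_div_two_pow_le hε0 hε1 hm
      have hm' : (1 : ℝ) ≤ m := by exact_mod_cast hm1
      have h1 := QGPE.natCeil_logb_le hε0 hε2
      rw [← hm] at h1
      rw [QGPE.cost_qgpe]
      push_cast
      linarith
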